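/- Let $n\ge 1$ and let $\mathcal W'=\{W_i\}_{i=1}^n$, $W_i=\{z\in\mathbb C^n : z_i\neq 0\}$, be the covering of $\mathbb C^n\smallsetminus 0$ by the complements of the coordinate hyperplanes. Write $\mathscr E^{(p,q)}$ for the sheaf of smooth $(p,q)$-forms, $\mathscr O^{(p)}$ for the sheaf of holomorphic $p$-forms, $C^a(\mathcal W';\mathscr S)=\prod_{(\alpha_0,\dots,\alpha_a)}\mathscr S(W_{\alpha_0}\cap\dots\cap W_{\alpha_a})$ (all $(a+1)$-tuples of indices) with the Čech differential $\check\delta$, and let $H^{p,q}_{\bar\vartheta}(\mathcal W')$ be the Čech–Dolbeault cohomology, i.e. the $q$-th cohomology of the complex $$\mathscr E^{(p,q)}(\mathcal W')=\bigoplus_{a+b=q}C^a(\mathcal W';\mathscr E^{(p,b)}),\qquad (\bar\vartheta\xi)^a=\check\delta\xi^{a-1}+(-1)^a\bar\partial\xi^a .$$ The inclusions of $\mathscr E^{(p,q)}(\mathbb C^n\smallsetminus 0)$ into bidegree $(0,q)$ (by restriction) and of $C^q(\mathcal W';\mathscr O^{(p)})$ into bidegree $(q,0)$ induce canonical linear maps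 $$H^{n,n-1}_{\bar\partial}(\mathbb C^n\smallsetminus 0)\overset{\iota}\longrightarrow H^{n,n-1}_{\bar\vartheta}(\mathcal W')\overset{j}\longleftarrow H^{n-1}(\mathcal W';\mathscr O^{(n)}).$$ (As $\mathcal W'$ is a Stein covering, $\iota$ and $j$ are isomorphisms, and $j^{-1}\circ\iota$ is the canonical isomorphism $H^{n,n-1}_{\bar\partial}(\mathbb C^n\smallsetminus 0)\simeq H^{n-1}(\mathcal W';\mathscr O^{(n)})$; two classes correspond under it if and only if they have the same image in $H^{n,n-1}_{\bar\vartheta}(\mathcal W')$.) Let $\varPhi=dz_1\wedge\dots\wedge dz_n$ and $\varPhi_i=(-1)^{i-1}z_i\,dz_1\wedge\dots\wedge\widehat{dz_i}\wedge\dots\wedge dz_n$, let $$\beta_n=C_n\,\frac{\sum_{i=1}^n\overline{\varPhi_i}\wedge\varPhi}{\|z\|^{2n}},\qquad C_n=(-1)^{\frac{n(n-1)}2}\frac{(n-1)!}{(2\pi\sqrt{-1})^n},$$ be the Bochner–Martinelli form on $\mathbb C^n\smallsetminus 0$, and let the Cauchy form $$\kappa_n=\Big(\frac1{2\pi\sqrt{-1}}\Big)^n\frac{\varPhi}{z_1\cdots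 z_n}$$ be regarded as the alternating cochain $c\in C^{n-1}(\mathcal W';\mathscr O^{(n)})$ with $c_{1\dots n}=\kappa_n$. Theorem. The form $\beta_n$ is $\bar\partial$-closed, the cochain $\kappa_n$ is a cocycle, and the class of $\beta_n$ corresponds to the class of $(-1)^{\frac{n(n-1)}2}\kappa_n$ under the canonical isomorphism: one has $$\iota[\beta_n]=j\big((-1)^{\frac{n(n-1)}2}[\kappa_n]\big)\quad\text{in } H^{n,n-1}_{\bar\vartheta}(\mathcal W'),$$ and $\Phi[\beta_n]=(-1)^{\frac{n(n-1)}2}[\kappa_n]$ for every linear isomorphism $\Phi:H^{n,n-1}_{\bar\partial}(\mathbb C^n\smallsetminus 0)\to H^{n-1}(\mathcal W';\mathscr O^{(n)})$ with $j\circ\Phi=\iota$. -/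

import Mathlib

open TopologicalSpace
open scoped ContDiff ComplexConjugate

noncomputable section

namespace CechDolbeault

/-! ### Alternating forms on complex Euclidean space -/

/-- The space `ℂⁿ` with the Euclidean norm. -/
abbrev Cn (n : ℕ) : Type := EuclideanSpace ℂ (Fin n)

/-- Complex valued `ℝ`-multilinear alternating `k`-forms on `ℂⁿ`. -/
abbrev AltForm (n k : ℕ) : Type := Cn n [⋀^Fin k]→L[ℝ] ℂ

/-- An alternating `(p + q)`-form is of type `(p, q)` when multiplying all of its arguments by a
complex number `c` multiplies its value by `c ^ p * conj c ^ q`.  Since a form of degree `p + q`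
is a sum of components of types `(a, b)` with `a + b = p + q`, this singles out the component of
type `(p, q)`, that is the span of the `dz_I ∧ dz̄_J` with `|I| = p` and `|J| = q`. -/
def IsOfType {n : ℕ} (p q : ℕ) (φ : AltForm n (p + q)) : Prop :=
  ∀ (c : ℂ) (v : Fin (p + q) → Cn n), φ (fun i => c • v i) = c ^ p * conj c ^ q * φ v

/-- The conjugate-linear part of an `ℝ`-linear map of complex vector spaces. -/
def antilinearPart {E F : Type*} [NormedAddCommGroup E] [NormedSpace ℂ E]
    [NormedAddCommGroup F] [NormedSpace ℂ F] (L : E →L[ℝ] F) : E →L[ℝ] F :=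
  (1 / 2 : ℂ) • (L + Complex.I • L.comp (Complex.I • ContinuousLinearMap.id ℝ E))

/-- The operator `∂̄` at a point.  It is the exterior derivative in which the derivative of the
coefficients is replaced by its conjugate-linear part:
`∂̄ (∑ f_{IJ} dz_I ∧ dz̄_J) = ∑ (∑_k ∂f_{IJ}/∂z̄_k dz̄_k) ∧ dz_I ∧ dz̄_J`. -/
def dbarAt {n k : ℕ} (η : Cn n → AltForm n k) (z : Cn n) : AltForm n (k + 1) :=
  .alternatizeUncurryFin (antilinearPart (fderiv ℝ η z))

lemma antilinearPart_apply {E F : Type*} [NormedAddCommGroup E] [NormedSpace ℂ E]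
    [NormedAddCommGroup F] [NormedSpace ℂ F] (L : E →L[ℝ] F) (v : E) :
    antilinearPart L v = (1 / 2 : ℂ) • (L v + Complex.I • L (Complex.I • v)) := by
  simp [antilinearPart]

lemma antilinearPart_add {E F : Type*} [NormedAddCommGroup E] [NormedSpace ℂ E]
    [NormedAddCommGroup F] [NormedSpace ℂ F] (L M : E →L[ℝ] F) :
    antilinearPart (L + M) = antilinearPart L + antilinearPart M := by
  ext v
  simp only [antilinearPart_apply, add_apply]
  module

lemma antilinearPart_smul {E F : Type*} [NormedAddCommGroup E] [NormedSpace ℂ E]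
    [NormedAddCommGroup F] [NormedSpace ℂ F] (c : ℂ) (L : E →L[ℝ] F) :
    antilinearPart (c • L) = c • antilinearPart L := by
  ext v
  simp only [antilinearPart_apply, smul_apply]
  module

lemma antilinearPart_map_smul {E F : Type*} [NormedAddCommGroup E] [NormedSpace ℂ E]
    [NormedAddCommGroup F] [NormedSpace ℂ F] (L : E →L[ℝ] F) (c : ℂ) (v : E) :
    antilinearPart L (c • v) = conj c • antilinearPart L v := by
  have key : ∀ w : E, L (c • w) = c.re • L w + c.im • L (Complex.I • w) := by
    intro w
    rw [← map_smul, ← map_smul, ← map_add]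
    congr 1
    conv_lhs => rw [← Complex.re_add_im c]
    rw [add_smul, mul_smul, Complex.coe_smul, Complex.coe_smul]
  have h2 : L (Complex.I • c • v) = c.re • L (Complex.I • v) - c.im • L v := by
    rw [smul_comm, key, smul_smul, Complex.I_mul_I, neg_one_smul, map_neg, smul_neg, sub_eq_add_neg]
  rw [antilinearPart_apply, antilinearPart_apply, key, h2]
  have hc : conj c = (c.re : ℂ) - c.im * Complex.I := by
    apply Complex.ext <;> simp
  rw [hc, ← Complex.coe_smul, ← Complex.coe_smul, ← Complex.coe_smul, ← Complex.coe_smul]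
  have hI : (Complex.I * Complex.I) = -1 := Complex.I_mul_I
  match_scalars <;> (first | linear_combination (1 / 2 * (c.im : ℂ)) * hI | linear_combination (c.im : ℂ) * hI | ring)

/-! ### Smooth forms of type `(p, q)` and holomorphic forms on open sets -/

/-- The smooth forms of type `(p, q)` on an open set `U`.  A form on `U` is represented by its
extension by zero to `ℂⁿ`, so that equality of forms on `U` is equality of functions. -/
def formsSubmodule {n : ℕ} (U : Opens (Cn n)) (p q : ℕ) :
    Submodule ℂ (Cn n → AltForm n (p + q)) where
  carrier := {η | ContDiffOn ℝ ∞ η U ∧ (∀ z, IsOfType p q (η z)) ∧ ∀ z ∉ U, η z = 0}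
  add_mem' := by
    rintro a b ⟨ha, ha', ha''⟩ ⟨hb, hb', hb''⟩
    refine ⟨ha.add hb, fun z c v => ?_, fun z hz => ?_⟩
    · simp [ha' z c v, hb' z c v, mul_add]
    · simp [ha'' z hz, hb'' z hz]
  zero_mem' := ⟨contDiffOn_const, fun z c v => by simp, fun z _ => rfl⟩
  smul_mem' := by
    rintro c a ⟨ha, ha', ha''⟩
    refine ⟨ha.const_smul c, fun z d v => ?_, fun z hz => ?_⟩
    · simp [ha' z d v, mul_left_comm]
    · simp [ha'' z hz]

/-- The space of smooth forms of type `(p, q)` on an open set `U`. -/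
def Forms {n : ℕ} (U : Opens (Cn n)) (p q : ℕ) : Type := formsSubmodule U p q

instance {n : ℕ} (U : Opens (Cn n)) (p q : ℕ) : AddCommGroup (Forms U p q) :=
  inferInstanceAs (AddCommGroup (formsSubmodule U p q))

instance {n : ℕ} (U : Opens (Cn n)) (p q : ℕ) : Module ℂ (Forms U p q) :=
  inferInstanceAs (Module ℂ (formsSubmodule U p q))

/-- The underlying form-valued function, extended by zero. -/
def Forms.val {n : ℕ} {U : Opens (Cn n)} {p q : ℕ} (η : Forms U p q) :
    Cn n → AltForm n (p + q) :=
  (formsSubmodule U p q).subtype η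

/-- Constructor of forms of type `(p, q)` on `U`. -/
def Forms.mk {n : ℕ} {U : Opens (Cn n)} {p q : ℕ} (η : Cn n → AltForm n (p + q))
    (h : η ∈ formsSubmodule U p q) : Forms U p q :=
  (⟨η, h⟩ : formsSubmodule U p q)

section FormsLemmas

variable {n : ℕ} {U : Opens (Cn n)} {p q : ℕ}

@[simp] lemma Forms.val_mk (η : Cn n → AltForm n (p + q)) (h : η ∈ formsSubmodule U p q) :
    (Forms.mk η h).val = η := rfl

@[simp] lemma Forms.val_add (η θ : Forms U p q) : (η + θ).val = η.val + θ.val := rfl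

@[simp] lemma Forms.val_smul (c : ℂ) (η : Forms U p q) : (c • η).val = c • η.val := rfl

@[simp] lemma Forms.val_zero : (0 : Forms U p q).val = 0 := rfl

lemma Forms.val_injective : Function.Injective (Forms.val : Forms U p q → _) :=
  Subtype.val_injective

lemma Forms.contDiffOn (η : Forms U p q) : ContDiffOn ℝ ∞ η.val U :=
  (show η.val ∈ formsSubmodule U p q from Subtype.property _).1

lemma Forms.isOfType (η : Forms U p q) (z : Cn n) : IsOfType p q (η.val z) :=
  (show η.val ∈ formsSubmodule U p q from Subtype.property _).2.1 z

lemma Forms.val_eq_zero (η : Forms U p q) {z : Cn n} (hz : z ∉ U) : η.val z = 0 :=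
  (show η.val ∈ formsSubmodule U p q from Subtype.property _).2.2 z hz

end FormsLemmas

/-- The holomorphic `p`-forms on `U`: the forms of type `(p, 0)` whose coefficients are
holomorphic. -/
def HolForms {n : ℕ} (U : Opens (Cn n)) (p : ℕ) : Submodule ℂ (Forms U p 0) where
  carrier := {η | DifferentiableOn ℂ η.val U}
  add_mem' := fun ha hb => DifferentiableOn.add ha hb
  zero_mem' := differentiableOn_const 0
  smul_mem' := fun c _ ha => DifferentiableOn.const_smul ha c

/-- Restriction of forms to a smaller open set. -/
def restrict {n : ℕ} {U V : Opens (Cn n)} (h : V ≤ U) (p q : ℕ) :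
    Forms U p q →ₗ[ℂ] Forms V p q where
  toFun η := .mk (Set.indicator (V : Set (Cn n)) η.val) (by
    refine ⟨(η.contDiffOn.mono h).congr fun z hz => Set.indicator_of_mem hz _, fun z => ?_,
      fun z hz => Set.indicator_of_notMem hz _⟩
    by_cases hz : z ∈ (V : Set (Cn n))
    · rw [Set.indicator_of_mem hz]; exact η.isOfType z
    · rw [Set.indicator_of_notMem hz]; intro c v; simp)
  map_add' a b := Forms.val_injective (Set.indicator_add _ _ _)
  map_smul' c a := Forms.val_injective (Set.indicator_const_smul (V : Set (Cn n)) c a.val)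

lemma dbarAt_contDiffOn {n k : ℕ} {U : Opens (Cn n)} {η : Cn n → AltForm n k}
    (h : ContDiffOn ℝ ∞ η U) : ContDiffOn ℝ ∞ (dbarAt η) U := by
  have h1 : ContDiffOn ℝ ∞ (fderiv ℝ η) U := h.fderiv_of_isOpen U.isOpen (by simp)
  have h2 : ContDiffOn ℝ ∞ (fun z => antilinearPart (fderiv ℝ η z)) U := by
    unfold antilinearPart
    exact (h1.add ((h1.clm_comp contDiffOn_const).const_smul _)).const_smul _
  exact (ContinuousAlternatingMap.alternatizeUncurryFinCLM ℝ (Cn n) ℂ).contDiff.comp_contDiffOn h2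

lemma dbarAt_add {n k : ℕ} {a b : Cn n → AltForm n k} {z : Cn n}
    (ha : DifferentiableAt ℝ a z) (hb : DifferentiableAt ℝ b z) :
    dbarAt (a + b) z = dbarAt a z + dbarAt b z := by
  rw [dbarAt, fderiv_add ha hb, antilinearPart_add,
    ContinuousAlternatingMap.alternatizeUncurryFin_add]
  rfl

lemma dbarAt_smul {n k : ℕ} {a : Cn n → AltForm n k} {z : Cn n} (c : ℂ)
    (ha : DifferentiableAt ℝ a z) : dbarAt (c • a) z = c • dbarAt a z := by
  rw [dbarAt, fderiv_const_smul ha, antilinearPart_smul,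
    ContinuousAlternatingMap.alternatizeUncurryFin_smul]
  rfl

lemma alternatize_antilinearPart_smul {n p q : ℕ} (L : Cn n →L[ℝ] AltForm n (p + q))
    (hL : ∀ (w : Cn n) (c : ℂ) (v : Fin (p + q) → Cn n),
      L w (fun i => c • v i) = c ^ p * conj c ^ q * L w v)
    (c : ℂ) (v : Fin (p + q + 1) → Cn n) :
    ContinuousAlternatingMap.alternatizeUncurryFin (antilinearPart L) (fun i => c • v i) =
      c ^ p * conj c ^ (q + 1) *
        ContinuousAlternatingMap.alternatizeUncurryFin (antilinearPart L) v := by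
  rw [ContinuousAlternatingMap.alternatizeUncurryFin_apply,
    ContinuousAlternatingMap.alternatizeUncurryFin_apply, Finset.mul_sum]
  refine Finset.sum_congr rfl fun i _ => ?_
  have h2 : i.removeNth (fun i => c • v i) = fun j => c • (i.removeNth v) j := rfl
  rw [antilinearPart_map_smul, h2, antilinearPart_apply]
  simp only [ContinuousAlternatingMap.smul_apply, ContinuousAlternatingMap.add_apply, hL]
  simp only [smul_eq_mul, zsmul_eq_mul]
  ring

lemma Forms.differentiableAt {n : ℕ} {U : Opens (Cn n)} {p q : ℕ} (η : Forms U p q) {z : Cn n}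
    (hz : z ∈ U) : DifferentiableAt ℝ η.val z :=
  (η.contDiffOn.contDiffAt (U.isOpen.mem_nhds hz)).differentiableAt (by simp)

lemma isOfType_dbarAt {n : ℕ} {U : Opens (Cn n)} {p q : ℕ} (η : Forms U p q) {z : Cn n}
    (hz : z ∈ U) : IsOfType p (q + 1) (dbarAt η.val z) := by
  refine alternatize_antilinearPart_smul _ fun w c v => ?_
  have e : ∀ u : Fin (p + q) → Cn n,
      HasFDerivAt (fun y => η.val y u)
        ((ContinuousAlternatingMap.apply ℝ (Cn n) ℂ u).comp (fderiv ℝ η.val z)) z := fun u =>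
    (ContinuousAlternatingMap.apply ℝ (Cn n) ℂ u).hasFDerivAt.comp z
      (η.differentiableAt hz).hasFDerivAt
  have e1 := e (fun i => c • v i)
  have e2 := (e v).const_mul (c ^ p * conj c ^ q)
  have e3 : (fun y => η.val y (fun i => c • v i)) = fun y => c ^ p * conj c ^ q * η.val y v :=
    funext fun y => η.isOfType y c v
  rw [e3] at e1
  have := congrArg (fun L : Cn n →L[ℝ] ℂ => L w) (e1.unique e2)
  simpa using this

/-- The operator `∂̄` from smooth forms of type `(p, q)` to smooth forms of type `(p, q + 1)`. -/
def dbar {n : ℕ} (U : Opens (Cn n)) (p q : ℕ) : Forms U p q →ₗ[ℂ] Forms U p (q + 1) where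
  toFun η := .mk (Set.indicator (U : Set (Cn n)) (dbarAt η.val)) (by
    refine ⟨(dbarAt_contDiffOn η.contDiffOn).congr fun z hz => Set.indicator_of_mem hz _, fun z => ?_,
      fun z hz => Set.indicator_of_notMem hz _⟩
    by_cases hz : z ∈ (U : Set (Cn n))
    · rw [Set.indicator_of_mem hz]; exact isOfType_dbarAt η hz
    · rw [Set.indicator_of_notMem hz]; intro c v; simp)
  map_add' a b := Forms.val_injective <| by
    refine Eq.trans ?_ (Set.indicator_add (U : Set (Cn n)) (dbarAt a.val) (dbarAt b.val))
    exact Set.indicator_congr fun z hz => dbarAt_add (a.differentiableAt hz) (b.differentiableAt hz)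
  map_smul' c a := Forms.val_injective <| by
    refine Eq.trans ?_ (Set.indicator_const_smul (U : Set (Cn n)) c (dbarAt a.val))
    exact Set.indicator_congr fun z hz => dbarAt_smul c (a.differentiableAt hz)

/-! ### Cohomology of a cochain complex -/

section Cohomology

variable {M : ℕ → Type*} [∀ q, AddCommGroup (M q)] [∀ q, Module ℂ (M q)]

/-- The coboundaries of degree `q`: the image of the preceding differential (zero for `q = 0`). -/
def coboundaries (d : ∀ q, M q →ₗ[ℂ] M (q + 1)) : ∀ q, Submodule ℂ (M q)
  | 0 => ⊥
  | q + 1 => LinearMap.range (d q)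

/-- The cohomology of degree `q`: the quotient of the space of cocycles by the subspace of those
cocycles that are coboundaries. -/
abbrev Cohomology (d : ∀ q, M q →ₗ[ℂ] M (q + 1)) (q : ℕ) : Type _ :=
  LinearMap.ker (d q) ⧸ (coboundaries d q).comap (LinearMap.ker (d q)).subtype

/-- The cohomology class of a cocycle. -/
def cohomClass (d : ∀ q, M q →ₗ[ℂ] M (q + 1)) (q : ℕ) (x : M q) (hx : d q x = 0) :
    Cohomology d q :=
  Submodule.Quotient.mk ⟨x, LinearMap.mem_ker.2 hx⟩

variable {N : ℕ → Type*} [∀ q, AddCommGroup (N q)] [∀ q, Module ℂ (N q)]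

/-- The map induced on cohomology by a morphism of complexes. -/
def cohomMap {d : ∀ q, M q →ₗ[ℂ] M (q + 1)} {e : ∀ q, N q →ₗ[ℂ] N (q + 1)}
    (f : ∀ q, M q →ₗ[ℂ] N q) (hf : ∀ q x, e q (f q x) = f (q + 1) (d q x)) (q : ℕ) :
    Cohomology d q →ₗ[ℂ] Cohomology e q :=
  Submodule.mapQ _ _
    ((f q).restrict (p := LinearMap.ker (d q)) (q := LinearMap.ker (e q)) fun x hx => by
      rw [LinearMap.mem_ker] at hx ⊢
      rw [hf, hx, map_zero])
    (by
      rintro ⟨x, hx⟩ hx'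
      simp only [Submodule.mem_comap, Submodule.subtype_apply, LinearMap.coe_restrict_apply]
        at hx' ⊢
      cases q with
      | zero =>
        have h0 : x = 0 := hx'
        rw [h0, map_zero]
        exact Submodule.zero_mem _
      | succ q =>
        obtain ⟨y, rfl⟩ := hx'
        exact ⟨f q y, hf q y⟩)

end Cohomology

/-! ### Čech and Čech–Dolbeault cochains of an open covering -/

section Cech

variable {n : ℕ} {ι : Type*}

/-- The intersection of the members of the family `W` with indices `α 0, …, α a`. -/
def inter (W : ι → Opens (Cn n)) {a : ℕ} (α : Fin (a + 1) → ι) : Opens (Cn n) :=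
  ⟨⋂ j, (W (α j) : Set (Cn n)), isOpen_iInter_of_finite fun j => (W (α j)).isOpen⟩

lemma inter_le_comp (W : ι → Opens (Cn n)) {a b : ℕ} (α : Fin (b + 1) → ι)
    (s : Fin (a + 1) → Fin (b + 1)) : inter W α ≤ inter W (α ∘ s) :=
  fun _ hz => Set.mem_iInter.2 fun j => Set.mem_iInter.1 hz (s j)

lemma inter_le_of_le {W : ι → Opens (Cn n)} {X : Opens (Cn n)} (hW : iSup W = X) {a : ℕ}
    (α : Fin (a + 1) → ι) : inter W α ≤ X :=
  fun _ hz => hW ▸ (le_iSup W (α 0)) (Set.mem_iInter.1 hz 0)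

/-- The Čech cochains of degree `a` with values in the sheaf of smooth `(p, q)`-forms. -/
abbrev CechCochain (W : ι → Opens (Cn n)) (p q a : ℕ) : Type _ :=
  ∀ α : Fin (a + 1) → ι, Forms (inter W α) p q

/-- The Čech differential. -/
def cechDiff (W : ι → Opens (Cn n)) (p q a : ℕ) :
    CechCochain W p q a →ₗ[ℂ] CechCochain W p q (a + 1) :=
  LinearMap.pi fun α => ∑ ν : Fin (a + 2), (-1 : ℂ) ^ (ν : ℕ) •
    (restrict (inter_le_comp W α ν.succAbove) p q ∘ₗ LinearMap.proj (α ∘ ν.succAbove))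

/-- The operator `∂̄` applied to each component of a Čech cochain. -/
def cechDbar (W : ι → Opens (Cn n)) (p q a : ℕ) :
    CechCochain W p q a →ₗ[ℂ] CechCochain W p (q + 1) a :=
  LinearMap.pi fun α => dbar (inter W α) p q ∘ₗ LinearMap.proj α

/-- The Čech cochains of degree `a` with values in the sheaf of holomorphic `p`-forms. -/
def HolCochain (W : ι → Opens (Cn n)) (p a : ℕ) : Submodule ℂ (CechCochain W p 0 a) :=
  Submodule.pi Set.univ fun α => HolForms (inter W α) p

lemma cechDiff_mem_holCochain (W : ι → Opens (Cn n)) (p a : ℕ) (σ : CechCochain W p 0 a)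
    (hσ : σ ∈ HolCochain W p a) : cechDiff W p 0 a σ ∈ HolCochain W p (a + 1) := by
  intro α _
  simp only [cechDiff, LinearMap.pi_apply, LinearMap.sum_apply, LinearMap.smul_apply,
    LinearMap.comp_apply, LinearMap.proj_apply]
  refine Submodule.sum_mem _ fun ν _ => Submodule.smul_mem _ _ ?_
  have h : DifferentiableOn ℂ (σ (α ∘ ν.succAbove)).val (inter W (α ∘ ν.succAbove)) :=
    hσ (α ∘ ν.succAbove) (Set.mem_univ _)
  exact (h.mono (inter_le_comp W α ν.succAbove)).congr fun z hz =>
    Set.indicator_of_mem hz (σ (α ∘ ν.succAbove)).val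

/-- The Čech differential on cochains with values in the sheaf of holomorphic `p`-forms. -/
def holDiff (W : ι → Opens (Cn n)) (p a : ℕ) : HolCochain W p a →ₗ[ℂ] HolCochain W p (a + 1) :=
  (cechDiff W p 0 a).restrict (cechDiff_mem_holCochain W p a)

/-- The Čech–Dolbeault cochains of type `(p, q)`: families of Čech cochains of degree `a` with
values in the smooth `(p, b)`-forms, for all `a + b = q`. -/
abbrev CDCochain (W : ι → Opens (Cn n)) (p q : ℕ) : Type _ :=
  ∀ ab : {ab : ℕ × ℕ // ab.1 + ab.2 = q}, CechCochain W p ab.1.2 ab.1.1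

/-- The Čech part of the Čech–Dolbeault differential. -/
def cdCechPart (W : ι → Opens (Cn n)) (p q : ℕ) :
    ∀ a b : ℕ, a + b = q + 1 → (CDCochain W p q →ₗ[ℂ] CechCochain W p b a)
  | 0, _, _ => 0
  | a + 1, b, h => cechDiff W p b a ∘ₗ
      LinearMap.proj (⟨(a, b), by simp; omega⟩ : {ab : ℕ × ℕ // ab.1 + ab.2 = q})

/-- The `∂̄` part (without sign) of the Čech–Dolbeault differential. -/
def cdDbarPart (W : ι → Opens (Cn n)) (p q : ℕ) :
    ∀ a b : ℕ, a + b = q + 1 → (CDCochain W p q →ₗ[ℂ] CechCochain W p b a)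
  | _, 0, _ => 0
  | a, b + 1, h => cechDbar W p b a ∘ₗ
      LinearMap.proj (⟨(a, b), by simp; omega⟩ : {ab : ℕ × ℕ // ab.1 + ab.2 = q})

/-- The Čech–Dolbeault differential
`(ϑ̄ ξ)^a = δ̌ ξ^(a - 1) + (-1)^a ∂̄ ξ^a`. -/
def cdDiff (W : ι → Opens (Cn n)) (p q : ℕ) : CDCochain W p q →ₗ[ℂ] CDCochain W p (q + 1) :=
  LinearMap.pi fun ab => cdCechPart W p q ab.1.1 ab.1.2 ab.2 +
    (-1 : ℂ) ^ ab.1.1 • cdDbarPart W p q ab.1.1 ab.1.2 ab.2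

/-- The Dolbeault cohomology `H^{p,q}_{∂̄}(X)`. -/
abbrev DolbeaultH (X : Opens (Cn n)) (p q : ℕ) : Type _ :=
  Cohomology (M := fun q => Forms X p q) (dbar X p) q

/-- The Čech cohomology `H^q(W; O^(p))` of the covering `W`. -/
abbrev CechH (W : ι → Opens (Cn n)) (p q : ℕ) : Type _ :=
  Cohomology (M := fun q => HolCochain W p q) (holDiff W p) q

/-- The Čech–Dolbeault cohomology `H^{p,q}_{ϑ̄}(W)` of the covering `W`. -/
abbrev CechDolbeaultH (W : ι → Opens (Cn n)) (p q : ℕ) : Type _ :=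
  Cohomology (M := fun q => CDCochain W p q) (cdDiff W p) q

/-- A form on `X` as a Čech–Dolbeault cochain: its restrictions to the members of the covering,
in bidegree `(0, q)`. -/
def formToCD {W : ι → Opens (Cn n)} {X : Opens (Cn n)} (hW : iSup W = X) (p q : ℕ) :
    Forms X p q →ₗ[ℂ] CDCochain W p q :=
  LinearMap.single ℂ (fun ab : {ab : ℕ × ℕ // ab.1 + ab.2 = q} => CechCochain W p ab.1.2 ab.1.1)
      ⟨(0, q), zero_add q⟩ ∘ₗ
    LinearMap.pi fun α : Fin 1 → ι => restrict (inter_le_of_le (a := 0) hW α) p q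

/-- A Čech cochain with values in the holomorphic `p`-forms as a Čech–Dolbeault cochain, in
bidegree `(q, 0)`. -/
def holToCD (W : ι → Opens (Cn n)) (p q : ℕ) : HolCochain W p q →ₗ[ℂ] CDCochain W p q :=
  LinearMap.single ℂ (fun ab : {ab : ℕ × ℕ // ab.1 + ab.2 = q} => CechCochain W p ab.1.2 ab.1.1)
      ⟨(q, 0), add_zero q⟩ ∘ₗ
    (HolCochain W p q).subtype

lemma restrict_apply_of_mem {U V : Opens (Cn n)} (h : V ≤ U) (p q : ℕ) (η : Forms U p q)
    {z : Cn n} (hz : z ∈ V) : (restrict h p q η).val z = η.val z :=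
  Set.indicator_of_mem (s := (V : Set (Cn n))) hz η.val

lemma Forms.ext_of_mem {U : Opens (Cn n)} {p q : ℕ} {η θ : Forms U p q}
    (h : ∀ z ∈ U, η.val z = θ.val z) : η = θ := by
  refine Forms.val_injective (funext fun z => ?_)
  by_cases hz : z ∈ U
  · exact h z hz
  · rw [η.val_eq_zero hz, θ.val_eq_zero hz]

lemma dbar_apply_of_mem {U : Opens (Cn n)} (p q : ℕ) (η : Forms U p q)
    {z : Cn n} (hz : z ∈ U) : (dbar U p q η).val z = dbarAt η.val z :=
  Set.indicator_of_mem (s := (U : Set (Cn n))) hz (dbarAt η.val)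

lemma dbar_restrict {U V : Opens (Cn n)} (h : V ≤ U) (p q : ℕ) (η : Forms U p q) :
    dbar V p q (restrict h p q η) = restrict h p (q + 1) (dbar U p q η) := by
  refine Forms.ext_of_mem fun z hz => ?_
  rw [dbar_apply_of_mem p q _ hz, restrict_apply_of_mem h p (q + 1) _ hz,
    dbar_apply_of_mem p q _ (h hz)]
  have : (restrict h p q η).val =ᶠ[nhds z] η.val :=
    Filter.eventually_of_mem (V.isOpen.mem_nhds hz) fun y hy => restrict_apply_of_mem h p q η hy
  rw [dbarAt, dbarAt, this.fderiv_eq]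

lemma dbar_eq_zero_of_mem_holForms {U : Opens (Cn n)} {p : ℕ} {η : Forms U p 0}
    (h : η ∈ HolForms U p) : dbar U p 0 η = 0 := by
  refine Forms.ext_of_mem fun z hz => ?_
  rw [dbar_apply_of_mem p 0 _ hz]
  have hd : DifferentiableAt ℂ η.val z :=
    (show DifferentiableOn ℂ η.val U from h).differentiableAt (U.isOpen.mem_nhds hz)
  have h0 : antilinearPart (fderiv ℝ η.val z) = 0 := by
    ext v w
    rw [antilinearPart_apply, hd.fderiv_restrictScalars ℝ, ContinuousLinearMap.coe_restrictScalars',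
      map_smul, smul_smul, Complex.I_mul_I]
    simp
  rw [dbarAt, h0]
  exact map_zero (ContinuousAlternatingMap.alternatizeUncurryFinCLM ℝ (Cn n) ℂ)

lemma formToCD_comm {W : ι → Opens (Cn n)} {X : Opens (Cn n)} (hW : iSup W = X) (p q : ℕ)
    (η : Forms X p q) :
    cdDiff W p q (formToCD hW p q η) = formToCD hW p (q + 1) (dbar X p q η) := by
  have hne : ∀ (q : ℕ) (η : Forms X p q) (a b : ℕ) (h : a + 1 + b = q),
      formToCD hW p q η ⟨(a + 1, b), h⟩ = 0 := fun q η a b h => by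
    rw [formToCD, LinearMap.comp_apply, LinearMap.single_apply]
    exact Pi.single_eq_of_ne (fun e => by simpa using congrArg (fun x => x.1.1) e) _
  have heq : ∀ (q : ℕ) (η : Forms X p q) (α : Fin 1 → ι),
      formToCD hW p q η ⟨(0, q), zero_add q⟩ α =
        restrict (inter_le_of_le (a := 0) hW α) p q η := fun q η α => by
    rw [formToCD, LinearMap.comp_apply, LinearMap.single_apply, Pi.single_eq_same]
    rfl
  funext ⟨⟨a, b⟩, h⟩
  change cdCechPart W p q a b h (formToCD hW p q η) +
    (-1 : ℂ) ^ a • cdDbarPart W p q a b h (formToCD hW p q η) = _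
  match a, b, h with
  | 0, b + 1, h =>
    obtain rfl : b = q := by simpa using h
    funext α
    have e : cdDbarPart W p b 0 (b + 1) h (formToCD hW p b η) α =
        dbar (inter W α) p b (formToCD hW p b η ⟨(0, b), zero_add b⟩ α) := rfl
    rw [heq, dbar_restrict] at e
    rw [heq, ← e]
    simp [cdCechPart]
  | 1, b, h =>
    obtain rfl : b = q := by simpa [add_comm] using h
    have e1 : cdCechPart W p b 1 b h (formToCD hW p b η) =
        cechDiff W p b 0 (formToCD hW p b η ⟨(0, b), zero_add b⟩) := rfl
    have e2 : cdDbarPart W p b 1 b h (formToCD hW p b η) = 0 := by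
      match b, h, η with
      | 0, _, _ => rfl
      | b + 1, h, η =>
        change cechDbar W p b 1 (formToCD hW p (b + 1) η ⟨(0 + 1, b), _⟩) = 0
        rw [hne, map_zero]
    have e3 : cechDiff W p b 0 (formToCD hW p b η ⟨(0, b), zero_add b⟩) = 0 := by
      funext α
      refine Forms.ext_of_mem fun z hz => ?_
      have r : ∀ ν : Fin 2, (restrict (inter_le_comp W α ν.succAbove) p b
          (formToCD hW p b η ⟨(0, b), zero_add b⟩ (α ∘ ν.succAbove))).val z = η.val z := by
        intro ν
        rw [restrict_apply_of_mem _ _ _ _ hz, heq,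
          restrict_apply_of_mem _ _ _ _ (inter_le_comp W α ν.succAbove hz)]
      change (∑ ν : Fin 2, (-1 : ℂ) ^ (ν : ℕ) • restrict (inter_le_comp W α ν.succAbove) p b
          (formToCD hW p b η ⟨(0, b), zero_add b⟩ (α ∘ ν.succAbove))).val z = 0
      rw [Fin.sum_univ_two, Forms.val_add, Pi.add_apply, Forms.val_smul, Forms.val_smul,
        Pi.smul_apply, Pi.smul_apply, r, r]
      ext v
      simp
    rw [e1, e2, e3, hne (b + 1) _ 0 b h, smul_zero, add_zero]
  | a + 2, b, h =>
    have e1 : cdCechPart W p q (a + 2) b h (formToCD hW p q η) = 0 := by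
      change cechDiff W p b (a + 1) (formToCD hW p q η ⟨(a + 1, b), _⟩) = 0
      rw [hne, map_zero]
    have e2 : cdDbarPart W p q (a + 2) b h (formToCD hW p q η) = 0 := by
      match b, h with
      | 0, _ => rfl
      | b + 1, h =>
        change cechDbar W p b (a + 2) (formToCD hW p q η ⟨(a + 1 + 1, b), _⟩) = 0
        rw [hne, map_zero]
    rw [e1, e2, hne (q + 1) _ (a + 1) b h, smul_zero, add_zero]

lemma holToCD_comm (W : ι → Opens (Cn n)) (p q : ℕ) (σ : HolCochain W p q) :
    cdDiff W p q (holToCD W p q σ) = holToCD W p (q + 1) (holDiff W p q σ) := by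
  have hne : ∀ (q : ℕ) (σ : HolCochain W p q) (a b : ℕ) (h : a + (b + 1) = q),
      holToCD W p q σ ⟨(a, b + 1), h⟩ = 0 := fun q σ a b h => by
    rw [holToCD, LinearMap.comp_apply, LinearMap.single_apply]
    exact Pi.single_eq_of_ne (fun e => by simpa using congrArg (fun x => x.1.2) e) _
  have heq : ∀ (q : ℕ) (σ : HolCochain W p q),
      holToCD W p q σ ⟨(q, 0), add_zero q⟩ = σ.1 := fun q σ => by
    rw [holToCD, LinearMap.comp_apply, LinearMap.single_apply, Pi.single_eq_same]
    rfl
  funext ⟨⟨a, b⟩, h⟩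
  change cdCechPart W p q a b h (holToCD W p q σ) +
    (-1 : ℂ) ^ a • cdDbarPart W p q a b h (holToCD W p q σ) = _
  match a, b, h with
  | a + 1, 0, h =>
    obtain rfl : a = q := by simpa using h
    have e1 : cdCechPart W p a (a + 1) 0 h (holToCD W p a σ) =
        cechDiff W p 0 a (holToCD W p a σ ⟨(a, 0), add_zero a⟩) := rfl
    rw [e1, heq, heq]
    change _ + (-1 : ℂ) ^ (a + 1) • (0 : CechCochain W p 0 (a + 1)) = _
    rw [smul_zero, add_zero]
    rfl
  | a, 1, h =>
    obtain rfl : a = q := by simpa using h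
    have e1 : cdCechPart W p a a 1 h (holToCD W p a σ) = 0 := by
      match a, h, σ with
      | 0, _, _ => rfl
      | a + 1, h, σ =>
        change cechDiff W p 1 a (holToCD W p (a + 1) σ ⟨(a, 0 + 1), _⟩) = 0
        rw [hne, map_zero]
    have e2 : cdDbarPart W p a a 1 h (holToCD W p a σ) = 0 := by
      change cechDbar W p 0 a (holToCD W p a σ ⟨(a, 0), add_zero a⟩) = 0
      rw [heq]
      funext α
      exact dbar_eq_zero_of_mem_holForms (σ.2 α (Set.mem_univ α))
    rw [e1, e2, hne (a + 1) _ a 0 h, smul_zero, add_zero]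
  | a, b + 2, h =>
    have e1 : cdCechPart W p q a (b + 2) h (holToCD W p q σ) = 0 := by
      match a, h with
      | 0, _ => rfl
      | a + 1, h =>
        change cechDiff W p (b + 2) a (holToCD W p q σ ⟨(a, b + 1 + 1), _⟩) = 0
        rw [hne, map_zero]
    have e2 : cdDbarPart W p q a (b + 2) h (holToCD W p q σ) = 0 := by
      change cechDbar W p (b + 1) a (holToCD W p q σ ⟨(a, b + 1), _⟩) = 0
      rw [hne, map_zero]
    rw [e1, e2, hne (q + 1) _ a (b + 1) h, smul_zero, add_zero]

/-- The canonical map `H^{p,q}_{∂̄}(X) → H^{p,q}_{ϑ̄}(W)`, for a covering `W` of `X`. -/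
def dolbeaultToCD {W : ι → Opens (Cn n)} {X : Opens (Cn n)} (hW : iSup W = X) (p q : ℕ) :
    DolbeaultH X p q →ₗ[ℂ] CechDolbeaultH W p q :=
  cohomMap (M := fun q => Forms X p q) (N := fun q => CDCochain W p q)
    (formToCD hW p) (formToCD_comm hW p) q

/-- The canonical map `H^q(W; O^(p)) → H^{p,q}_{ϑ̄}(W)`. -/
def cechToCD (W : ι → Opens (Cn n)) (p q : ℕ) : CechH W p q →ₗ[ℂ] CechDolbeaultH W p q :=
  cohomMap (M := fun q => HolCochain W p q) (N := fun q => CDCochain W p q)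
    (holToCD W p) (holToCD_comm W p) q

end Cech

/-! ### The covering of the punctured space, the Bochner–Martinelli form and the Cauchy form -/

/-- The open set `ℂⁿ ∖ 0`. -/
def punctured (n : ℕ) : Opens (Cn n) := ⟨{0}ᶜ, isOpen_compl_singleton⟩

/-- The open sets `W_i = {z_i ≠ 0}`. -/
def coordCover (n : ℕ) (i : Fin n) : Opens (Cn n) :=
  ⟨{z | z i ≠ 0}, isOpen_ne_fun (by fun_prop) continuous_const⟩

lemma iSup_coordCover (n : ℕ) : iSup (coordCover n) = punctured n := by
  ext z
  simp only [Opens.coe_iSup, Set.mem_iUnion, SetLike.mem_coe]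
  change (∃ i, z i ≠ 0) ↔ z ≠ 0
  rw [← not_iff_not]
  push Not
  exact ⟨fun h => PiLp.ext h, fun h i => by rw [h]; rfl⟩

/-- The exterior product `a_1 ∧ … ∧ a_k` of `1`-forms, whose value at `v` is `det (a_i (v_j))`. -/
def wedge {n k : ℕ} (a : Fin k → (Cn n →L[ℝ] ℂ)) : AltForm n k :=
  ContinuousMultilinearMap.alternatization
    ((ContinuousMultilinearMap.mkPiAlgebra ℝ (Fin k) ℂ).compContinuousLinearMap a)

lemma wedge_apply {n k : ℕ} (a : Fin k → (Cn n →L[ℝ] ℂ)) (v : Fin k → Cn n) :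
    wedge a v = (Matrix.of fun i j => a i (v j)).det := by
  rw [← Matrix.det_transpose, Matrix.det_apply]
  simp [wedge, ContinuousMultilinearMap.alternatization_apply_apply]

/-- The `1`-form `dz_i`. -/
def dz {n : ℕ} (i : Fin n) : Cn n →L[ℝ] ℂ :=
  (EuclideanSpace.proj i : Cn n →L[ℂ] ℂ).restrictScalars ℝ

/-- The `1`-form `dz̄_i`. -/
def dzbar {n : ℕ} (i : Fin n) : Cn n →L[ℝ] ℂ := (Complex.conjCLE : ℂ →L[ℝ] ℂ).comp (dz i)

@[simp] lemma dz_apply {n : ℕ} (i : Fin n) (v : Cn n) : dz i v = v i := rfl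

@[simp] lemma dzbar_apply {n : ℕ} (i : Fin n) (v : Cn n) : dzbar i v = conj (v i) := rfl

lemma wedge_smul {n k : ℕ} (a : Fin k → (Cn n →L[ℝ] ℂ)) (c : ℂ) (f : Fin k → ℂ)
    (hf : ∀ i v, a i (c • v) = f i * a i v) (v : Fin k → Cn n) :
    wedge a (fun i => c • v i) = (∏ i, f i) * wedge a v := by
  rw [wedge_apply, wedge_apply, ← Matrix.det_mul_column]
  simp only [hf, Matrix.of_apply]

/-- The form `dz̄_1 ∧ … ∧ (dz̄_i omitted) ∧ … ∧ dz̄_n ∧ dz_1 ∧ … ∧ dz_n` with `n = m + 1`. -/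
def dzbarOmitDz (m : ℕ) (i : Fin (m + 1)) : AltForm (m + 1) (m + 1 + m) :=
  wedge fun j => Fin.append (fun l : Fin m => dzbar (i.succAbove l))
    (fun l : Fin (m + 1) => dz l) (Fin.cast (add_comm (m + 1) m) j)

/-- The values of the Bochner–Martinelli form of `ℂⁿ`, `n = m + 1`:
`C_n (∑_i (-1)^(i - 1) z̄_i dz̄_1 ∧ … ∧ (dz̄_i omitted) ∧ … ∧ dz̄_n ∧ dz_1 ∧ … ∧ dz_n) / ‖z‖^(2n)`
with `C_n = (-1)^(n(n-1)/2) (n-1)! / (2πi)^n`.  (The index `i` starts at `0` in the code.) -/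
def bmValue (m : ℕ) (z : Cn (m + 1)) : AltForm (m + 1) (m + 1 + m) :=
  (((-1) ^ ((m + 1) * m / 2) * (m.factorial : ℂ) / (2 * Real.pi * Complex.I) ^ (m + 1)) /
      (‖z‖ : ℂ) ^ (2 * (m + 1))) •
    ∑ i : Fin (m + 1), ((-1) ^ (i : ℕ) * conj (z i)) • dzbarOmitDz m i

/-- The values of the Cauchy form `(1 / (2πi))^n dz_1 ∧ … ∧ dz_n / (z_1 ⋯ z_n)`, `n = m + 1`. -/
def cauchyValue (m : ℕ) (z : Cn (m + 1)) : AltForm (m + 1) (m + 1) :=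
  ((1 / (2 * Real.pi * Complex.I)) ^ (m + 1) / ∏ i, z i) • wedge fun i => dz i

lemma isOfType_dzbarOmitDz (m : ℕ) (i : Fin (m + 1)) : IsOfType (m + 1) m (dzbarOmitDz m i) := by
  intro c v
  rw [dzbarOmitDz, wedge_smul _ c
    (fun j => Fin.append (fun _ : Fin m => conj c) (fun _ : Fin (m + 1) => c)
      (Fin.cast (add_comm (m + 1) m) j))]
  · congr 1
    have := Fintype.prod_equiv (finCongr (add_comm (m + 1) m))
      (fun j => Fin.append (fun _ : Fin m => conj c) (fun _ : Fin (m + 1) => c)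
        (Fin.cast (add_comm (m + 1) m) j))
      (fun j => Fin.append (fun _ : Fin m => conj c) (fun _ : Fin (m + 1) => c) j)
      (fun _ => rfl)
    rw [this, Fin.prod_univ_add]
    simp [mul_comm]
  · intro j w
    refine Fin.addCases (fun l => ?_) (fun l => ?_) (Fin.cast (add_comm (m + 1) m) j)
    · rw [Fin.append_left, Fin.append_left]
      simp
    · rw [Fin.append_right, Fin.append_right]
      simp

lemma isOfType_wedge_dz (n : ℕ) : IsOfType n 0 (wedge fun i : Fin n => dz i) := by
  intro c v
  have := wedge_smul (fun i : Fin n => dz i) c (fun _ => c) (fun i w => by simp) v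
  simpa using this

lemma IsOfType.smul {n p q : ℕ} {φ : AltForm n (p + q)} (h : IsOfType p q φ) (a : ℂ) :
    IsOfType p q (a • φ) := by
  intro c v
  rw [ContinuousAlternatingMap.smul_apply, ContinuousAlternatingMap.smul_apply, h c v,
    smul_eq_mul, smul_eq_mul]
  ring

lemma IsOfType.sum {n p q : ℕ} {κ : Type*} (s : Finset κ) {φ : κ → AltForm n (p + q)}
    (h : ∀ i ∈ s, IsOfType p q (φ i)) : IsOfType p q (∑ i ∈ s, φ i) := by
  intro c v
  rw [ContinuousAlternatingMap.sum_apply, ContinuousAlternatingMap.sum_apply, Finset.mul_sum]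
  exact Finset.sum_congr rfl fun i hi => h i hi c v

/-- The Bochner–Martinelli form as a smooth form of type `(n, n - 1)` on `ℂⁿ ∖ 0`, `n = m + 1`. -/
def bochnerMartinelli (m : ℕ) : Forms (punctured (m + 1)) (m + 1) m :=
  .mk (bmValue m) (by
    refine ⟨?_, fun z => ?_, fun z hz => ?_⟩
    · have hn : ContDiffOn ℝ ∞ (fun z : Cn (m + 1) => (‖z‖ : ℂ) ^ (2 * (m + 1)))
          (punctured (m + 1)) := by
        have h1 : ContDiffOn ℝ ∞ (fun z : Cn (m + 1) => ‖z‖) (punctured (m + 1)) :=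
          contDiffOn_id.norm ℝ fun z hz => hz
        exact (Complex.ofRealCLM.contDiff.comp_contDiffOn h1).pow _
      unfold bmValue
      refine ContDiffOn.fun_smul ?_ ?_
      · simp only [div_eq_mul_inv _ ((_ : ℂ) ^ (2 * (m + 1)))]
        refine contDiffOn_const.mul (hn.inv fun z hz => ?_)
        exact pow_ne_zero _ (Complex.ofReal_ne_zero.2 (norm_ne_zero_iff.2 hz))
      · refine ContDiffOn.sum fun i _ => ContDiffOn.fun_smul ?_ contDiffOn_const
        exact contDiffOn_const.mul (dzbar i).contDiff.contDiffOn
    · exact (IsOfType.sum _ fun i _ => (isOfType_dzbarOmitDz m i).smul _).smul _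
    · have : z = 0 := not_not.1 hz
      ext v
      simp [bmValue, this])

lemma differentiableOn_cauchyValue (m : ℕ) (α : Fin (m + 1) → Fin (m + 1))
    (hα : Function.Bijective α) :
    DifferentiableOn ℂ (cauchyValue m) (inter (coordCover (m + 1)) α) ∧
      ContDiffOn ℝ ∞ (cauchyValue m) (inter (coordCover (m + 1)) α) := by
  have h0 : ∀ z ∈ inter (coordCover (m + 1)) α, ∏ i, z i ≠ 0 := fun z hz =>
    Finset.prod_ne_zero_iff.2 fun i _ => by
      obtain ⟨j, rfl⟩ := hα.2 i
      exact Set.mem_iInter.1 hz j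
  constructor
  · have h1 : DifferentiableOn ℂ (fun z : Cn (m + 1) => ∏ i, z i)
        (inter (coordCover (m + 1)) α) :=
      (contDiffOn_prod (n := 1) fun i _ =>
        (EuclideanSpace.proj i : Cn (m + 1) →L[ℂ] ℂ).contDiff.contDiffOn).differentiableOn
          one_ne_zero
    exact ((h1.inv h0).const_mul _).smul_const _
  · unfold cauchyValue
    refine ContDiffOn.fun_smul ?_ contDiffOn_const
    simp only [div_eq_mul_inv _ (∏ i, _)]
    refine contDiffOn_const.mul (ContDiffOn.inv ?_ h0)
    exact contDiffOn_prod fun i _ => (dz i).contDiff.contDiffOn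

/-- The Cauchy form as a form of type `(n, 0)` on the intersection of all the `W_i`, `n = m + 1`. -/
def cauchyForm (m : ℕ) (α : Fin (m + 1) → Fin (m + 1)) (hα : Function.Bijective α) :
    Forms (inter (coordCover (m + 1)) α) (m + 1) 0 :=
  .mk (cauchyValue m) (by
    refine ⟨(differentiableOn_cauchyValue m α hα).2, fun z => (isOfType_wedge_dz (m + 1)).smul _,
      fun z hz => ?_⟩
    have hz' : ∃ i, z i = 0 := by
      by_contra h
      push Not at h
      exact hz (Set.mem_iInter.2 fun j => h (α j))
    obtain ⟨i, hi⟩ := hz'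
    ext v
    simp [cauchyValue, Finset.prod_eq_zero (Finset.mem_univ i) hi])

/-- The Cauchy form as a Čech cochain of degree `n - 1`, `n = m + 1`: the alternating cochain `c`
with `c_{1…n}` the Cauchy form. -/
def cauchyCochain (m : ℕ) : HolCochain (coordCover (m + 1)) (m + 1) m :=
  ⟨fun α => open Classical in if hα : Function.Bijective α then
      ((Equiv.Perm.sign (Equiv.ofBijective α hα) : ℤ) : ℂ) • cauchyForm m α hα else 0, by
    intro α _
    dsimp only
    split_ifs with hα
    · exact Submodule.smul_mem _ _ (differentiableOn_cauchyValue m α hα).1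
    · exact Submodule.zero_mem _⟩

/-- The class of the Bochner–Martinelli form in `H^{n,n-1}_{∂̄}(ℂⁿ ∖ 0)`, `n = m + 1`. -/
def bochnerMartinelliClass (m : ℕ)
    (h : dbar (punctured (m + 1)) (m + 1) m (bochnerMartinelli m) = 0) :
    DolbeaultH (punctured (m + 1)) (m + 1) m :=
  cohomClass (M := fun q => Forms (punctured (m + 1)) (m + 1) q) _ m (bochnerMartinelli m) h

/-- The class of the Cauchy form in `H^{n-1}(W; O^(n))`, `n = m + 1`, where `W` is the covering of
`ℂⁿ ∖ 0` by the sets `{z_i ≠ 0}`. -/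
def cauchyClass (m : ℕ)
    (h : holDiff (coordCover (m + 1)) (m + 1) m (cauchyCochain m) = 0) :
    CechH (coordCover (m + 1)) (m + 1) m :=
  cohomClass (M := fun q => HolCochain (coordCover (m + 1)) (m + 1) q) _ m (cauchyCochain m) h

end CechDolbeault

end

open CechDolbeault

/-! Write ρ = ‖z‖², vol = dz̄_1 ∧ … ∧ dz̄_n ∧ dz_1 ∧ … ∧ dz_n, and ι_u for contraction with the (0,
1)-component of u (`contr`). The two cocycles are joined by an explicit tower of kernels
(`kernelValue`), K_α = (∏_j z_{α j})⁻¹ ρ^{-(b+1)} ι_z ι_{e_{α 0}} … ι_{e_{α (k-1)}} vol, with b + 1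
+ k = n. For k = 0 this is the Bochner–Martinelli form up to a constant (`bmValue_eq`).

Three facts give ∂̄ of the kernels. A constant form G of type (p, q + 1) satisfies ∂̄(ι_z G) = (q +
1) G (`alternatizeUncurryFin_contr`). The contraction ι_z is an antiderivation with ι_z ∂̄ρ = ρ
(`contr_wedgeOne`). The form ∂̄ρ ∧ vol vanishes for degree reasons, so ∂̄ρ ∧ ι_{e_{α 0}} … vol
expands with coefficients ± z_{α j}, each cancelling one denominator. Hence ∂̄K_α = (b + 1) ∑_j
(-1)^j K_{α without j}, which is a Čech differential (`dbarAt_kernelValue_succ`). With n indices the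
alternating sum of the kernels with b = 0 is the Cauchy cochain up to a constant
(`sum_kernelValue`). Suitable multiples of the K_α therefore form a Čech–Dolbeault cochain whose
coboundary is the difference of the two cocycles (`cdDiff_interpCochain`). The sign in C_n cancels
the sign accumulated along the tower; what remains is the sign of contracting vol with e_1, …, e_n.
For n = 1 there is no lower degree and the two cocycles coincide.

The statement about Φ needs only that ι is injective (`dolbeaultToCD_injective`) and Φ surjective:
if Φ x is the Cauchy side, then ι x = j (Φ x) = ι [β_n], so x = [β_n]. Injectivity of ι is the usual
consequence of a partition of unity, which supplies a homotopy for the Čech complex of smooth forms;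
neither Stein theory nor injectivity of j is used. -/

noncomputable section

namespace CechDolbeault

/-! ### Contractions by antiholomorphic vectors -/

section Contraction

variable {n k : ℕ}

/-- The contraction of an alternating form by the component of type `(0, 1)` of a real tangent
vector. -/
def contr (G : AltForm n (k + 1)) : Cn n →L[ℝ] AltForm n k := antilinearPart G.curryLeft

lemma contr_apply (G : AltForm n (k + 1)) (u : Cn n) (w : Fin k → Cn n) :
    contr G u w = 1 / 2 * (G (Fin.cons u w) + Complex.I * G (Fin.cons (Complex.I • u) w)) := by
  rw [contr, antilinearPart_apply]
  rfl

lemma contr_map_smul (G : AltForm n (k + 1)) (c : ℂ) (u : Cn n) :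
    contr G (c • u) = conj c • contr G u :=
  antilinearPart_map_smul _ c u

lemma contr_add (G H : AltForm n (k + 1)) : contr (G + H) = contr G + contr H := by
  rw [contr, ContinuousAlternatingMap.curryLeft_add, antilinearPart_add]
  rfl

lemma contr_smul (c : ℂ) (G : AltForm n (k + 1)) : contr (c • G) = c • contr G :=
  antilinearPart_smul c G.curryLeft

lemma contr_real_smul (c : ℝ) (G : AltForm n (k + 1)) : contr (c • G) = c • contr G :=
  (congrArg contr (Complex.coe_smul c G)).symm.trans
    ((contr_smul c G).trans (Complex.coe_smul c (contr G)))

lemma contr_zero : contr (0 : AltForm n (k + 1)) = 0 := by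
  ext u w
  simp [contr_apply]

lemma contr_sum {κ : Type*} (s : Finset κ) (G : κ → AltForm n (k + 1)) :
    contr (∑ i ∈ s, G i) = ∑ i ∈ s, contr (G i) := by
  classical
  induction s using Finset.induction_on with
  | empty => simp [contr_zero]
  | insert i s hi ih => rw [Finset.sum_insert hi, Finset.sum_insert hi, contr_add, ih]

lemma antilinearPart_antilinearPart {E F : Type*} [NormedAddCommGroup E] [NormedSpace ℂ E]
    [NormedAddCommGroup F] [NormedSpace ℂ F] (L : E →L[ℝ] F) :
    antilinearPart (antilinearPart L) = antilinearPart L := by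
  ext v
  rw [antilinearPart_apply, antilinearPart_map_smul, smul_smul, Complex.conj_I, mul_neg,
    Complex.I_mul_I, neg_neg, one_smul]
  module

lemma contr_contr_comm (G : AltForm n (k + 2)) (u v : Cn n) :
    contr (contr G u) v = -contr (contr G v) u := by
  have h : ∀ a b (w : Fin k → Cn n),
      G (Fin.cons a (Fin.cons b w)) = -G (Fin.cons b (Fin.cons a w)) := fun a b w => by
    have := G.toAlternatingMap.map_swap (Fin.cons b (Fin.cons a w)) (Fin.zero_ne_one (n := k))
    refine Eq.trans (congrArg G ?_) this
    funext i
    refine Fin.cases ?_ (fun i => Fin.cases ?_ (fun i => ?_) i) i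
    · simp
    · simp
    · rw [Function.comp_apply, Equiv.swap_apply_of_ne_of_ne (Fin.succ_ne_zero _)]
      · rfl
      · exact fun h => Fin.succ_ne_zero i (Fin.succ_injective _ h)
  ext w
  rw [ContinuousAlternatingMap.neg_apply]
  simp only [contr_apply]
  rw [h v u, h v, h (Complex.I • v) u, h (Complex.I • v)]
  ring

lemma contr_contr_self (G : AltForm n (k + 2)) (u : Cn n) : contr (contr G u) u = 0 := by
  ext w
  have := congrArg (fun H : AltForm n k => H w) (contr_contr_comm G u u)
  exact self_eq_neg.1 this

/-- The exterior product of a `1`-form and a form. -/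
def wedgeOne (τ : Cn n →L[ℝ] ℂ) (G : AltForm n k) : AltForm n (k + 1) :=
  .alternatizeUncurryFin (τ.smulRight G)

lemma wedgeOne_apply (τ : Cn n →L[ℝ] ℂ) (G : AltForm n k) (w : Fin (k + 1) → Cn n) :
    wedgeOne τ G w = ∑ i : Fin (k + 1), (-1) ^ (i : ℕ) * (τ (w i) * G (i.removeNth w)) := by
  rw [wedgeOne, ContinuousAlternatingMap.alternatizeUncurryFin_apply]
  refine Finset.sum_congr rfl fun i _ => ?_
  simp

lemma wedgeOne_cons (τ : Cn n →L[ℝ] ℂ) (G : AltForm n (k + 1)) (u : Cn n)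
    (w : Fin (k + 1) → Cn n) :
    wedgeOne τ G (Fin.cons u w) = τ u * G w -
      ∑ i : Fin (k + 1), (-1) ^ (i : ℕ) * (τ (w i) * G (Fin.cons u (i.removeNth w))) := by
  rw [wedgeOne_apply, Fin.sum_univ_succ, sub_eq_add_neg, ← Finset.sum_neg_distrib]
  congr 1
  · simp
  · refine Finset.sum_congr rfl fun i _ => ?_
    have : (i.succ.removeNth (Fin.cons u w : Fin (k + 2) → Cn n) : Fin (k + 1) → Cn n) =
        Fin.cons u (i.removeNth w) := by
      funext j
      refine Fin.cases ?_ (fun j => ?_) j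
      · simp [Fin.removeNth]
      · simp [Fin.removeNth, Fin.succ_succAbove_succ]
    rw [this, Fin.cons_succ, Fin.val_succ, pow_succ]
    ring

/-- Contraction is an antiderivation. The hypothesis says that τ is of type (0, 1), so that
contracting τ itself gives all of τ u. -/
lemma contr_wedgeOne {τ : Cn n →L[ℝ] ℂ} (hτ : ∀ w, τ (Complex.I • w) = -Complex.I * τ w)
    (G : AltForm n (k + 1)) (u : Cn n) :
    contr (wedgeOne τ G) u = τ u • G - wedgeOne τ (contr G u) := by
  ext w
  rw [ContinuousAlternatingMap.sub_apply, ContinuousAlternatingMap.smul_apply, contr_apply,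
    wedgeOne_cons, wedgeOne_cons, wedgeOne_apply, hτ, smul_eq_mul]
  simp only [contr_apply]
  have h : ∑ i : Fin (k + 1), (-1 : ℂ) ^ (i : ℕ) * (τ (w i) * (1 / 2 *
      (G (Fin.cons u (i.removeNth w)) +
        Complex.I * G (Fin.cons (Complex.I • u) (i.removeNth w))))) =
      1 / 2 * (∑ i : Fin (k + 1), (-1 : ℂ) ^ (i : ℕ) * (τ (w i) *
        G (Fin.cons u (i.removeNth w))) + Complex.I * ∑ i : Fin (k + 1), (-1 : ℂ) ^ (i : ℕ) *
        (τ (w i) * G (Fin.cons (Complex.I • u) (i.removeNth w)))) := by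
    rw [Finset.mul_sum, ← Finset.sum_add_distrib, Finset.mul_sum]
    exact Finset.sum_congr rfl fun i _ => by ring
  rw [h]
  linear_combination (-(1 / 2) * τ u * G w) * Complex.I_mul_I

lemma wedgeOne_zero (τ : Cn n →L[ℝ] ℂ) : wedgeOne τ (0 : AltForm n k) = 0 := by
  ext w; simp [wedgeOne_apply]

/-- There are no nonzero forms of degree greater than `2n`. -/
lemma AltForm.eq_zero_of_lt (h : n + n < k) (G : AltForm n k) : G = 0 := by
  ext w
  refine G.toAlternatingMap.map_linearDependent w fun hw => ?_
  have := hw.fintype_card_le_finrank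
  rw [Fintype.card_fin, finrank_real_of_complex, finrank_euclideanSpace, Fintype.card_fin] at this
  omega

/-- Contraction lowers the type `(p, q + 1)` to `(p, q)`. -/
lemma IsOfType.contr {p q : ℕ} {G : AltForm n (p + (q + 1))} (hG : IsOfType p (q + 1) G)
    (u : Cn n) : IsOfType p q (contr (k := p + q) G u) := by
  -- The degree becomes a variable `k`, tied to `p + q` only by a hypothesis, so that it can be
  -- split into cases and substituted.
  have key : ∀ {k : ℕ} (G : AltForm n (k + 1)), k = p + q →
      (∀ (c : ℂ) (v : Fin (k + 1) → Cn n), G (fun i => c • v i) =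
        c ^ p * conj c ^ (q + 1) * G v) → ∀ (c : ℂ) (w : Fin k → Cn n),
      CechDolbeault.contr G u (fun i => c • w i) =
        c ^ p * conj c ^ q * CechDolbeault.contr G u w := by
    intro k G hk hG c w
    by_cases hc : c = 0
    · rcases Nat.eq_zero_or_pos k with h | h
      · obtain ⟨hp, hq⟩ : p = 0 ∧ q = 0 := by omega
        subst hp hq h
        simp only [pow_zero, one_mul]
        congr 1
        exact Subsingleton.elim _ _
      · have e : c ^ p * conj c ^ q = 0 := by
          rw [hc, map_zero, ← pow_add, zero_pow (hk ▸ h.ne')]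
        rw [e, zero_mul, hc]
        exact ContinuousAlternatingMap.map_coord_zero _ (⟨0, h⟩ : Fin k) (zero_smul ℂ _)
    -- Writing v = c • (c⁻¹ • v) scales all arguments of G at once; conjugate-linearity of the
    -- contraction then removes one factor conj c. This is why c = 0 was treated separately.
    · have e : ∀ v : Cn n, (Fin.cons v (fun i => c • w i) : Fin (k + 1) → Cn n) =
          fun i => c • (Fin.cons (c⁻¹ • v) w : Fin (k + 1) → Cn n) i := fun v => by
        funext i
        refine Fin.cases ?_ (fun i => ?_) i
        · simp [smul_smul, hc]
        · simp
      have e1 : CechDolbeault.contr G u (fun i => c • w i) =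
          c ^ p * conj c ^ (q + 1) * CechDolbeault.contr G (c⁻¹ • u) w := by
        rw [contr_apply, contr_apply, e, e, hG, hG, smul_comm Complex.I]
        ring
      have hc' : conj c ≠ 0 := by simpa using hc
      rw [e1, contr_map_smul, ContinuousAlternatingMap.smul_apply, smul_eq_mul, map_inv₀, pow_succ]
      field_simp
  exact key G rfl hG

/-- The Euler identity for forms of type `(p, q + 1)`. -/
lemma alternatizeUncurryFin_contr {p q : ℕ} {G : AltForm n (p + (q + 1))}
    (hG : IsOfType p (q + 1) G) :
    ContinuousAlternatingMap.alternatizeUncurryFin (contr (k := p + q) G) = ((q : ℂ) + 1) • G := by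
  have key : ∀ {k : ℕ} (G : AltForm n (k + 1)), k = p + q →
      (∀ (c : ℂ) (v : Fin (k + 1) → Cn n), G (fun i => c • v i) =
        c ^ p * conj c ^ (q + 1) * G v) →
      ContinuousAlternatingMap.alternatizeUncurryFin (contr G) = ((q : ℂ) + 1) • G := by
    intro k G hk hG
    ext w
    have e1 : ∀ (i : Fin (k + 1)) (v : Cn n),
        (-1 : ℂ) ^ (i : ℕ) * G (Fin.cons v (i.removeNth w)) = G (Function.update w i v) := by
      intro i v
      have := G.toAlternatingMap.map_insertNth i v (i.removeNth w)
      rw [Fin.insertNth_removeNth] at this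
      refine Eq.trans ?_ this.symm
      rw [zsmul_eq_mul]
      push_cast
      rfl
    -- The derivative at t = 0 of G((1 + it) w) is computed twice: by multilinearity here, and from
    -- the type of G in `e4`. Comparing the two evaluates the sum of the terms with one argument
    -- multiplied by i.
    have e2 : HasDerivAt (fun t : ℝ => G (w + t • (Complex.I • w)))
        (∑ i, G (Function.update w i (Complex.I • w i))) 0 := by
      have h1 := G.toContinuousMultilinearMap.hasFDerivAt w
      have h2 : HasDerivAt (fun t : ℝ => w + t • (Complex.I • w)) (Complex.I • w) 0 := by
        simpa using ((hasDerivAt_id (0 : ℝ)).smul_const (Complex.I • w)).const_add w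
      have h3 : HasFDerivAt G.toContinuousMultilinearMap
        (G.toContinuousMultilinearMap.linearDeriv w)
        (w + (0 : ℝ) • (Complex.I • w)) := by simpa using h1
      have := h3.comp_hasDerivAt (0 : ℝ) h2
      rw [ContinuousMultilinearMap.linearDeriv_apply] at this
      exact this
    have e3 : (fun t : ℝ => G (w + t • (Complex.I • w))) =
        fun t : ℝ => (1 + t * Complex.I) ^ p * (1 - t * Complex.I) ^ (q + 1) * G w := by
      funext t
      have e : (w + t • (Complex.I • w)) = fun i => (1 + t * Complex.I) • w i := by
        funext i
        rw [Pi.add_apply, Pi.smul_apply, Pi.smul_apply, add_smul, one_smul, mul_smul,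
          Complex.coe_smul]
      rw [e, hG]
      simp [sub_eq_add_neg]
    have e4 : HasDerivAt
        (fun t : ℝ => (1 + t * Complex.I) ^ p * (1 - t * Complex.I) ^ (q + 1) * G w)
        ((p * Complex.I - (q + 1) * Complex.I) * G w) 0 := by
      have h0 : HasDerivAt (fun t : ℝ => (t : ℂ) * Complex.I) Complex.I 0 := by
        simpa using (Complex.ofRealCLM.hasDerivAt (x := (0 : ℝ))).mul_const Complex.I
      have h1 := (h0.const_add 1).fun_pow p
      have h2 := (h0.const_sub 1).fun_pow (q + 1)
      have := (h1.fun_mul h2).mul_const (G w)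
      refine this.congr_deriv ?_
      simp only [Complex.ofReal_zero, zero_mul, add_zero, sub_zero, one_pow]
      push_cast
      ring
    rw [e3] at e2
    have e5 := e2.unique e4
    rw [ContinuousAlternatingMap.alternatizeUncurryFin_apply, ContinuousAlternatingMap.smul_apply,
      smul_eq_mul]
    have e6 : ∀ i : Fin (k + 1), (-1 : ℤ) ^ (i : ℕ) • contr G (w i) (i.removeNth w) =
        1 / 2 * (G w + Complex.I * G (Function.update w i (Complex.I • w i))) := fun i => by
      have h1 := e1 i (w i)
      rw [Function.update_eq_self] at h1
      rw [contr_apply, ← e1, zsmul_eq_mul]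
      push_cast
      refine Eq.trans ?_ (congrArg (fun x => 1 / 2 * (x + _)) h1)
      ring
    rw [Finset.sum_congr rfl fun i _ => e6 i, ← Finset.mul_sum, Finset.sum_add_distrib,
      ← Finset.mul_sum, e5]
    simp only [Finset.sum_const, Finset.card_univ, Fintype.card_fin, nsmul_eq_mul]
    have hk' : (k : ℂ) = p + q := by rw [hk, Nat.cast_add]
    push_cast
    rw [hk']
    linear_combination (1 / 2 * ((p : ℂ) - (q + 1)) * G w) * Complex.I_mul_I
  exact key G rfl hG

end Contraction

/-! ### Contractions of the volume form -/

section Volume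

variable {n b : ℕ}

/-- This is Laplace expansion of the determinant along its first column, followed by taking the
conjugate-linear part in u. -/
lemma contr_wedge {k : ℕ} (a : Fin (k + 1) → (Cn n →L[ℝ] ℂ)) (u : Cn n) :
    contr (wedge a) u =
      ∑ r : Fin (k + 1), ((-1) ^ (r : ℕ) * antilinearPart (a r) u) •
        wedge fun j => a (r.succAbove j) := by
  have h : ∀ (u : Cn n) (w : Fin k → Cn n), wedge a (Fin.cons u w) =
      ∑ r : Fin (k + 1), (-1) ^ (r : ℕ) * a r u * wedge (fun j => a (r.succAbove j)) w := by
    intro u w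
    rw [wedge_apply, Matrix.det_succ_column_zero]
    refine Finset.sum_congr rfl fun r _ => ?_
    rw [wedge_apply]
    rfl
  ext w
  rw [contr_apply, h, h, ContinuousAlternatingMap.sum_apply, Finset.mul_sum,
    ← Finset.sum_add_distrib, Finset.mul_sum]
  refine Finset.sum_congr rfl fun r _ => ?_
  rw [ContinuousAlternatingMap.smul_apply, antilinearPart_apply, smul_eq_mul, smul_eq_mul,
    smul_eq_mul]
  ring

lemma antilinearPart_dz (i : Fin n) (u : Cn n) : antilinearPart (dz i) u = 0 := by
  rw [antilinearPart_apply, dz_apply, dz_apply, PiLp.smul_apply, smul_eq_mul, smul_eq_mul,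
    smul_eq_mul]
  linear_combination (1 / 2 * u i) * Complex.I_mul_I

lemma antilinearPart_dzbar (i : Fin n) (u : Cn n) : antilinearPart (dzbar i) u = conj (u i) := by
  rw [antilinearPart_apply, dzbar_apply, dzbar_apply, PiLp.smul_apply, smul_eq_mul, smul_eq_mul,
    smul_eq_mul, map_mul, Complex.conj_I]
  linear_combination (-1 / 2 * conj (u i)) * Complex.I_mul_I

/-- The form `dz̄_{L 0} ∧ … ∧ dz̄_{L (b - 1)} ∧ dz_1 ∧ … ∧ dz_n`. -/
def dzbarDz (L : Fin b → Fin n) : AltForm n (n + b) :=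
  wedge fun j => Fin.append (fun l : Fin b => dzbar (L l)) (fun l : Fin n => dz l)
    (Fin.cast (add_comm n b) j)

lemma isOfType_dzbarDz (L : Fin b → Fin n) : IsOfType n b (dzbarDz L) := by
  intro c v
  rw [dzbarDz, wedge_smul _ c
    (fun j => Fin.append (fun _ : Fin b => conj c) (fun _ : Fin n => c)
      (Fin.cast (add_comm n b) j))]
  · congr 1
    have := Fintype.prod_equiv (finCongr (add_comm n b))
      (fun j => Fin.append (fun _ : Fin b => conj c) (fun _ : Fin n => c)
        (Fin.cast (add_comm n b) j))
      (fun j => Fin.append (fun _ : Fin b => conj c) (fun _ : Fin n => c) j)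
      (fun _ => rfl)
    rw [this, Fin.prod_univ_add]
    simp [mul_comm]
  · intro j w
    refine Fin.addCases (fun l => ?_) (fun l => ?_) (Fin.cast (add_comm n b) j)
    · rw [Fin.append_left, Fin.append_left]
      simp
    · rw [Fin.append_right, Fin.append_right]
      simp

/-- The factors dz have no conjugate-linear part, so only the removal of a factor dz̄ survives. -/
lemma contr_dzbarDz (L : Fin (b + 1) → Fin n) (u : Cn n) :
    contr (n := n) (k := n + b) (dzbarDz (n := n) (b := b + 1) L) u =
      ∑ r : Fin (b + 1), ((-1) ^ (r : ℕ) * conj (u (L r))) • dzbarDz fun j => L (r.succAbove j) := by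
  rw [dzbarDz]
  refine (contr_wedge (k := n + b) _ u).trans ?_
  have hc : b + 1 + n = n + b + 1 := by omega
  -- Reindexing the degree as `b + 1 + n` lets the sum split into the block of the dz̄ and the block
  -- of the dz.
  rw [← Equiv.sum_comp (finCongr hc), Fin.sum_univ_add]
  refine (add_eq_left.2 ?_).trans ?_
  · refine Finset.sum_eq_zero fun r _ => ?_
    have : Fin.append (fun l : Fin (b + 1) => dzbar (L l)) (fun l : Fin n => dz l)
        (Fin.cast (add_comm n (b + 1)) (finCongr hc (Fin.natAdd (b + 1) r))) = dz r :=
      Fin.append_right _ _ r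
    rw [this, antilinearPart_dz, mul_zero]
    ext w
    simp
  · refine Finset.sum_congr rfl fun r _ => ?_
    congr 1
    · congr 1
      have : Fin.append (fun l : Fin (b + 1) => dzbar (L l)) (fun l : Fin n => dz l)
          (Fin.cast (add_comm n (b + 1)) (finCongr hc (Fin.castAdd n r))) = dzbar (L r) :=
        Fin.append_left _ _ r
      rw [this, antilinearPart_dzbar]
    · rw [dzbarDz]
      congr 1
      funext j
      obtain ⟨j, rfl⟩ := (finCongr (add_comm b n)).surjective j
      refine Fin.addCases (fun l => ?_) (fun l => ?_) j
      · have e : Fin.cast (add_comm n (b + 1)) ((finCongr hc (Fin.castAdd n r)).succAbove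
            (finCongr (add_comm b n) (Fin.castAdd n l))) = Fin.castAdd n (r.succAbove l) := by
          ext
          simp only [Fin.succAbove, Fin.lt_def]
          simp
          split_ifs <;> simp
        have e' : Fin.cast (add_comm n b) (finCongr (add_comm b n) (Fin.castAdd n l)) =
          Fin.castAdd n l := rfl
        rw [e, e', Fin.append_left, Fin.append_left]
      · have e : Fin.cast (add_comm n (b + 1)) ((finCongr hc (Fin.castAdd n r)).succAbove
            (finCongr (add_comm b n) (Fin.natAdd b l))) = Fin.natAdd (b + 1) l := by
          have : ¬ ((l : ℕ) + b < r) := by omega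
          ext
          simp only [Fin.succAbove, Fin.lt_def]
          simp [this]
          omega
        have e' : Fin.cast (add_comm n b) (finCongr (add_comm b n) (Fin.natAdd b l)) =
          Fin.natAdd b l := rfl
        rw [e, e', Fin.append_right, Fin.append_right]

lemma dzbarDz_elim0 (L : Fin 0 → Fin n) : dzbarDz L = wedge fun i : Fin n => dz i := by
  rw [dzbarDz]
  congr 1
  funext j
  have : Fin.cast (add_comm n 0) j = Fin.natAdd 0 j := by
    ext
    simp
  rw [this, Fin.append_right]

lemma contr_wedge_dz {m : ℕ} (u : Cn (m + 1)) :
    contr (wedge fun i : Fin (m + 1) => dz i) u = 0 := by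
  rw [contr_wedge]
  refine Finset.sum_eq_zero fun r _ => ?_
  rw [antilinearPart_dz, mul_zero]
  ext w
  simp

/-- The contraction of the volume form `dz̄_1 ∧ … ∧ dz̄_n ∧ dz_1 ∧ … ∧ dz_n` by `k` vectors of
type `(0, 1)`. -/
def iterContr : ∀ (k b : ℕ), b + k = n → (Fin k → Cn n) → AltForm n (n + b)
  | 0, _, h, _ => dzbarDz (Fin.castLE h.le)
  | k + 1, b, h, v =>
    contr (k := n + b) (iterContr k (b + 1) (by omega) (Fin.tail v)) (v 0)

lemma iterContr_succ (k b : ℕ) (h : b + (k + 1) = n) (v : Fin (k + 1) → Cn n) :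
    iterContr (k + 1) b h v =
      contr (k := n + b) (iterContr k (b + 1) (by omega) (Fin.tail v)) (v 0) := rfl

lemma isOfType_iterContr (k b : ℕ) (h : b + k = n) (v : Fin k → Cn n) :
    IsOfType n b (iterContr k b h v) := by
  induction k generalizing b with
  | zero => exact isOfType_dzbarDz _
  | succ k ih => exact (ih (b + 1) _ _).contr _

lemma tail_succ_removeNth {E : Type*} {k : ℕ} (v : Fin (k + 2) → E) (j : Fin (k + 1)) :
    Fin.tail (j.succ.removeNth v) = j.removeNth (Fin.tail v) := by
  funext i
  simp [Fin.tail, Fin.removeNth, Fin.succ_succAbove_succ]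

/-- Induction with the antiderivation rule moves τ inward past one contraction at a time. The
process stops because τ ∧ vol has degree 2n + 1 and vanishes. -/
lemma wedgeOne_iterContr {τ : Cn n →L[ℝ] ℂ} (hτ : ∀ w, τ (Complex.I • w) = -Complex.I * τ w)
    (k b : ℕ) (h : b + (k + 1) = n) (v : Fin (k + 1) → Cn n) :
    wedgeOne τ (iterContr (k + 1) b h v) = ∑ j : Fin (k + 1), ((-1) ^ (j : ℕ) * τ (v j)) •
      iterContr k (b + 1) (by omega) (j.removeNth v) := by
  induction k generalizing b with
  | zero =>
    have h1 := contr_wedgeOne hτ (k := n + b) (iterContr 0 (b + 1) (by omega) (Fin.tail v)) (v 0)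
    rw [AltForm.eq_zero_of_lt (by omega)
      (wedgeOne τ (iterContr 0 (b + 1) (by omega) (Fin.tail v))), contr_zero] at h1
    rw [Fin.sum_univ_one, iterContr_succ]
    refine (sub_eq_zero.1 h1.symm).symm.trans ?_
    rw [Fin.val_zero, pow_zero, one_mul]
    rfl
  | succ k ih =>
    have h1 := contr_wedgeOne hτ (k := n + b)
      (iterContr (k + 1) (b + 1) (by omega) (Fin.tail v)) (v 0)
    rw [ih (b + 1) (by omega) (Fin.tail v)] at h1
    rw [iterContr_succ, Fin.sum_univ_succ]
    refine (eq_sub_of_add_eq (eq_sub_iff_add_eq'.1 h1)).trans ?_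
    rw [sub_eq_add_neg]
    congr 1
    · rw [Fin.val_zero, pow_zero, one_mul]
      rfl
    · refine Eq.trans (congrArg (fun L : Cn n →L[ℝ] _ => -L (v 0)) (contr_sum (k := n + b + 1) _ _)) ?_
      rw [sum_apply, ← Finset.sum_neg_distrib]
      refine Finset.sum_congr rfl fun j _ => ?_
      rw [iterContr_succ, tail_succ_removeNth, contr_smul]
      have e : (j.succ.removeNth v : Fin (k + 1) → Cn n) 0 = v 0 := by simp [Fin.removeNth]
      have e' : Fin.tail v j = v j.succ := rfl
      rw [e, e', Fin.val_succ, pow_succ]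
      ext w
      simp only [smul_apply, ContinuousAlternatingMap.smul_apply,
        ContinuousAlternatingMap.neg_apply, smul_eq_mul]
      ring

/-- Contractions anticommute, so the new one can be moved inward until it meets its twin, and ι_u
ι_u = 0. -/
lemma contr_iterContr_self (k b : ℕ) (h : b + 1 + k = n) (v : Fin k → Cn n) (j : Fin k) :
    contr (k := n + b) (iterContr k (b + 1) h v) (v j) = 0 := by
  induction k generalizing b with
  | zero => exact j.elim0
  | succ k ih =>
    rw [iterContr_succ]
    refine Fin.cases ?_ (fun j => ?_) j
    · exact contr_contr_self (k := n + b) _ _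
    · refine (contr_contr_comm (k := n + b) _ _ _).trans ?_
      have := ih (b + 1) (by omega) (Fin.tail v) j
      rw [neg_eq_zero]
      refine Eq.trans (congrArg (fun G => contr (k := n + b) G (v 0)) this) ?_
      rw [contr_zero]
      rfl

lemma iterContr_eq_zero (k b : ℕ) (h : b + k = n) (v : Fin k → Cn n) {i j : Fin k}
    (hij : i ≠ j) (hv : v i = v j) : iterContr k b h v = 0 := by
  induction k generalizing b with
  | zero => exact i.elim0
  | succ k ih =>
    rw [iterContr_succ]
    revert hij hv
    refine Fin.cases ?_ (fun i => ?_) i <;> refine Fin.cases ?_ (fun j => ?_) j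
    · exact fun h => (h rfl).elim
    · intro _ hv
      rw [hv]
      exact contr_iterContr_self k b (by omega) (Fin.tail v) j
    · intro _ hv
      rw [← hv]
      exact contr_iterContr_self k b (by omega) (Fin.tail v) i
    · intro hij hv
      rw [ih (b + 1) (by omega) (Fin.tail v) (fun h => hij (congrArg _ h)) hv]
      exact congrArg (fun L : Cn n →L[ℝ] AltForm n (n + b) => L (v 0)) contr_zero

lemma iterContr_update_add (k b : ℕ) (h : b + k = n) (v : Fin k → Cn n) (i : Fin k) (x y : Cn n) :
    iterContr k b h (Function.update v i (x + y)) =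
      iterContr k b h (Function.update v i x) + iterContr k b h (Function.update v i y) := by
  induction k generalizing b with
  | zero => exact i.elim0
  | succ k ih =>
    simp only [iterContr_succ]
    refine Fin.cases ?_ (fun i => ?_) i
    · simp only [Fin.tail_update_zero, Function.update_self, map_add]
    · simp only [Fin.tail_update_succ, ih,
        Function.update_of_ne (Fin.succ_ne_zero i).symm]
      exact congrArg (fun L : Cn n →L[ℝ] AltForm n (n + b) => L (v 0)) (contr_add _ _)

lemma iterContr_update_smul (k b : ℕ) (h : b + k = n) (v : Fin k → Cn n) (i : Fin k) (c : ℝ)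
    (x : Cn n) : iterContr k b h (Function.update v i (c • x)) =
      c • iterContr k b h (Function.update v i x) := by
  induction k generalizing b with
  | zero => exact i.elim0
  | succ k ih =>
    simp only [iterContr_succ]
    refine Fin.cases ?_ (fun i => ?_) i
    · simp only [Fin.tail_update_zero, Function.update_self, map_smul]
    · simp only [Fin.tail_update_succ, ih,
        Function.update_of_ne (Fin.succ_ne_zero i).symm]
      exact congrArg (fun L : Cn n →L[ℝ] AltForm n (n + b) => L (v 0)) (contr_real_smul _ _)

/-- The iterated contraction of the volume form, as an alternating map of the vectors. -/
def iterContrAlt (k b : ℕ) (h : b + k = n) : Cn n [⋀^Fin k]→ₗ[ℝ] AltForm n (n + b) where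
  toFun := iterContr k b h
  map_update_add' v i x y := by
    convert iterContr_update_add k b h v i x y
  map_update_smul' v i c x := by
    convert iterContr_update_smul k b h v i c x
  map_eq_zero_of_eq' v i j hv hij := iterContr_eq_zero k b h v hij hv

/-- Packaging the iterated contraction as an alternating map yields the permutation sign, which
later matches the sign in the alternating Cauchy cochain. -/
lemma iterContr_comp_perm (k b : ℕ) (h : b + k = n) (v : Fin k → Cn n) (σ : Equiv.Perm (Fin k)) :
    iterContr k b h (v ∘ σ) = (((Equiv.Perm.sign σ : ℤˣ) : ℤ) : ℂ) • iterContr k b h v := by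
  have := (iterContrAlt k b h).map_perm v σ
  refine this.trans ?_
  rw [Units.smul_def]
  ext w
  change ((Equiv.Perm.sign σ : ℤˣ) : ℤ) • (iterContr k b h v w) = _
  rw [zsmul_eq_mul]
  rfl

/-- The standard basis vectors of `ℂⁿ`. -/
def stdVec (i : Fin n) : Cn n := EuclideanSpace.single i 1

/-- The innermost contraction acts first. Contracting with the basis vector of index l, counted from
0, then removes the last remaining dz̄, which has l factors in front of it and contributes (-1)^l.
-/
lemma iterContr_stdVec (k b : ℕ) (h : b + k = n) :
    iterContr k b h (fun j => stdVec ⟨b + j, by omega⟩) =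
      (-1 : ℂ) ^ (∑ l ∈ Finset.Ico b n, l) • dzbarDz (Fin.castLE (show b ≤ n by omega)) := by
  induction k generalizing b with
  | zero =>
    obtain rfl : b = n := h
    rw [Finset.Ico_self, Finset.sum_empty, pow_zero, one_smul]
    rfl
  | succ k ih =>
    have e : Fin.tail (fun j : Fin (k + 1) => stdVec (⟨b + j, by omega⟩ : Fin n)) =
        fun j : Fin k => stdVec ⟨b + 1 + j, by omega⟩ := by
      funext j
      simp only [Fin.tail, Fin.val_succ]
      congr 2
      omega
    rw [iterContr_succ, e, ih (b + 1) (by omega)]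
    refine Eq.trans (congrArg (fun L : Cn n →L[ℝ] AltForm n (n + b) => L _)
      (contr_smul (k := n + b) _ _)) ?_
    rw [smul_apply, contr_dzbarDz, Finset.sum_eq_single (Fin.last b)]
    · have e1 : (stdVec (⟨b + ((0 : Fin (k + 1)) : ℕ), by omega⟩ : Fin n))
          (Fin.castLE (show b + 1 ≤ n by omega) (Fin.last b)) = 1 := by
        simp only [stdVec]
        rw [PiLp.single_apply, if_pos]
        ext
        simp
      rw [e1, map_one, mul_one, smul_smul, ← pow_add, Fin.val_last,
        Finset.sum_eq_sum_Ico_succ_bot (show b < n by omega),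
        Nat.add_comm (∑ l ∈ _, l) b]
      simp only [Fin.succAbove_last]
      rfl
    · intro r _ hr
      have e1 : (stdVec (⟨b + ((0 : Fin (k + 1)) : ℕ), by omega⟩ : Fin n))
          (Fin.castLE (show b + 1 ≤ n by omega) r) = 0 := by
        simp only [stdVec]
        rw [PiLp.single_apply, if_neg]
        intro h
        apply hr
        ext
        simpa using congrArg Fin.val h
      rw [e1, map_zero, mul_zero]
      ext w
      simp
    · simp

/-- Source of the sign in the theorem: removing all n factors dz̄ costs 0 + 1 + … + (n - 1) =
n(n-1)/2 transpositions. -/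
lemma iterContr_stdVec_comp {m : ℕ} (α : Fin (m + 1) → Fin (m + 1)) (hα : Function.Bijective α) :
    iterContr (m + 1) 0 (zero_add _) (fun j => stdVec (α j)) =
      ((-1 : ℂ) ^ ((m + 1) * m / 2) * ((Equiv.Perm.sign (Equiv.ofBijective α hα) : ℤ) : ℂ)) •
        (wedge fun i : Fin (m + 1) => dz i) := by
  have h1 := iterContr_comp_perm (n := m + 1) (m + 1) 0 (zero_add _) stdVec (Equiv.ofBijective α hα)
  have h2 := iterContr_stdVec (n := m + 1) (m + 1) 0 (zero_add _)
  have e : (fun j : Fin (m + 1) => stdVec (⟨0 + j, by omega⟩ : Fin (m + 1))) = stdVec := by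
    funext j
    congr 1
    ext
    simp
  rw [e, dzbarDz_elim0, ← Finset.range_eq_Ico, Finset.sum_range_id, Nat.add_sub_cancel] at h2
  rw [h2] at h1
  refine Eq.trans h1 ?_
  rw [smul_smul, mul_comm]

/-- No dz̄ is left to contract: for bijective α the form is a multiple of dz_1 ∧ … ∧ dz_n, and
otherwise a repeated index already makes it zero. -/
lemma contr_iterContr_stdVec {m : ℕ} (α : Fin (m + 1) → Fin (m + 1)) (u : Cn (m + 1)) :
    contr (k := m) (iterContr (m + 1) 0 (zero_add _) (fun j => stdVec (α j))) u = 0 := by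
  by_cases hα : Function.Bijective α
  · rw [iterContr_stdVec_comp α hα]
    refine Eq.trans (congrArg (fun L : Cn (m + 1) →L[ℝ] AltForm (m + 1) m => L u)
      (contr_smul (k := m) _ _)) ?_
    rw [smul_apply, contr_wedge_dz]
    ext w
    simp
  · have : ¬ Function.Injective α := fun h => hα (Finite.injective_iff_bijective.1 h)
    simp only [Function.Injective, not_forall] at this
    obtain ⟨i, j, hij, hne⟩ := this
    rw [iterContr_eq_zero _ _ _ _ hne (show stdVec (α i) = stdVec (α j) by rw [hij])]
    refine Eq.trans (congrArg (fun L : Cn (m + 1) →L[ℝ] AltForm (m + 1) m => L u)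
      (contr_zero (k := m))) ?_
    rfl

/-- The expansion of the iterated contractions by `m` of `m + 1` standard basis vectors. -/
lemma sum_contr_iterContr_stdVec {m : ℕ} {τ : Cn (m + 1) →L[ℝ] ℂ}
    (hτ : ∀ w, τ (Complex.I • w) = -Complex.I * τ w) (α : Fin (m + 1) → Fin (m + 1))
    (u : Cn (m + 1)) :
    ∑ j : Fin (m + 1), ((-1) ^ (j : ℕ) * τ (stdVec (α j))) •
      contr (k := m + 1) (iterContr m 1 (by omega) (fun i => stdVec (α (j.succAbove i)))) u =
        τ u • iterContr (m + 1) 0 (zero_add _) (fun j => stdVec (α j)) := by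
  -- Apply ι_u to the expansion of τ ∧ ι_{α 0} … ι_{α m} vol. The antiderivation rule leaves only τ
  -- u times the form, because contracting it once more gives zero.
  have h1 := wedgeOne_iterContr hτ m 0 (zero_add _) (fun j => stdVec (α j))
  have h2 := contr_wedgeOne hτ (k := m) (iterContr (m + 1) 0 (zero_add _)
    (fun j => stdVec (α j))) u
  rw [contr_iterContr_stdVec, wedgeOne_zero, sub_zero] at h2
  refine Eq.trans ?_ h2
  refine Eq.trans ?_ (congrArg (fun G => contr (k := m + 1) G u) h1.symm)
  refine Eq.trans ?_ (congrArg (fun L : Cn (m + 1) →L[ℝ] _ => L u)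
    (contr_sum (k := m + 1) _ _)).symm
  rw [sum_apply]
  refine Finset.sum_congr rfl fun j _ => ?_
  exact (congrArg (fun L : Cn (m + 1) →L[ℝ] _ => L u) (contr_smul (k := m + 1) _ _)).symm

end Volume

/-! ### The kernels interpolating between the Bochner–Martinelli and the Cauchy form -/

section Kernels

variable {n : ℕ}

/-- The form `∑ z_i dz̄_i = ∂̄ ‖z‖²`. -/
def dbarNormSq (z : Cn n) : Cn n →L[ℝ] ℂ := ∑ i, z i • dzbar i

lemma dbarNormSq_apply (z w : Cn n) : dbarNormSq z w = ∑ i, z i * conj (w i) := by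
  simp [dbarNormSq, sum_apply]

lemma dbarNormSq_I_smul (z w : Cn n) :
    dbarNormSq z (Complex.I • w) = -Complex.I * dbarNormSq z w := by
  rw [dbarNormSq_apply, dbarNormSq_apply, Finset.mul_sum]
  refine Finset.sum_congr rfl fun i _ => ?_
  rw [PiLp.smul_apply, smul_eq_mul, map_mul, Complex.conj_I]
  ring

lemma norm_sq_eq_sum (z : Cn n) : (‖z‖ : ℂ) ^ 2 = ∑ i, z i * conj (z i) := by
  rw [← Complex.ofReal_pow, EuclideanSpace.norm_sq_eq, Complex.ofReal_sum]
  refine Finset.sum_congr rfl fun i _ => ?_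
  rw [Complex.mul_conj, Complex.normSq_eq_norm_sq]

lemma dbarNormSq_self (z : Cn n) : dbarNormSq z z = (‖z‖ : ℂ) ^ 2 := by
  rw [dbarNormSq_apply, norm_sq_eq_sum]

lemma dbarNormSq_stdVec (z : Cn n) (i : Fin n) : dbarNormSq z (stdVec i) = z i := by
  rw [dbarNormSq_apply, Finset.sum_eq_single i]
  · simp [stdVec]
  · intro j _ hj
    simp [stdVec, hj]
  · simp

lemma hasFDerivAt_norm_sq (z : Cn n) :
    HasFDerivAt (fun y : Cn n => (‖y‖ : ℂ) ^ 2) (∑ i, (z i • dzbar i + conj (z i) • dz i)) z := by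
  have : (fun y : Cn n => (‖y‖ : ℂ) ^ 2) = fun y => ∑ i, dz i y * dzbar i y := by
    funext y
    simp [norm_sq_eq_sum]
  rw [this]
  exact HasFDerivAt.fun_sum fun i _ => (dz i).hasFDerivAt.mul (dzbar i).hasFDerivAt

lemma antilinearPart_eq_zero {E F : Type*} [NormedAddCommGroup E] [NormedSpace ℂ E]
    [NormedAddCommGroup F] [NormedSpace ℂ F] (L : E →L[ℂ] F) :
    antilinearPart (L.restrictScalars ℝ) = 0 := by
  ext v
  rw [antilinearPart_apply]
  simp [smul_smul]

lemma antilinearPart_fderiv_norm_sq (z : Cn n) :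
    antilinearPart (∑ i, (z i • dzbar i + conj (z i) • dz i)) = dbarNormSq z := by
  ext w
  rw [antilinearPart_apply, dbarNormSq_apply]
  simp only [sum_apply, add_apply, smul_apply, dzbar_apply, dz_apply, smul_eq_mul,
    PiLp.smul_apply, map_mul, Complex.conj_I]
  rw [Finset.mul_sum, ← Finset.sum_add_distrib, Finset.mul_sum]
  refine Finset.sum_congr rfl fun i _ => ?_
  linear_combination (1 / 2 * (conj (z i) * w i - z i * conj (w i))) * Complex.I_mul_I

/-- The conjugate-linear part of the derivative of `h / ‖z‖ ^ (2 (r + 1))` for a holomorphic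
`h`. -/
lemma exists_hasFDerivAt_div_norm_pow {z : Cn n} (hz : z ≠ 0) {h : Cn n → ℂ}
    (hh : DifferentiableAt ℂ h z) (r : ℕ) :
    ∃ g' : Cn n →L[ℝ] ℂ, HasFDerivAt (fun y => h y / ((‖y‖ : ℂ) ^ 2) ^ (r + 1)) g' z ∧
      antilinearPart g' = (-((r + 1) * h z / ((‖z‖ : ℂ) ^ 2) ^ (r + 2))) • dbarNormSq z := by
  have hρ : (‖z‖ : ℂ) ^ 2 ≠ 0 :=
    pow_ne_zero _ (Complex.ofReal_ne_zero.2 (norm_ne_zero_iff.2 hz))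
  have h1 := hh.hasFDerivAt.restrictScalars ℝ
  have h2 := (((hasDerivAt_id ((‖z‖ : ℂ) ^ 2)).fun_pow (r + 1)).fun_inv
    (pow_ne_zero (r + 1) hρ)).hasFDerivAt.restrictScalars ℝ
  have h3 := h1.fun_mul (h2.comp z (hasFDerivAt_norm_sq z))
  refine ⟨_, h3, ?_⟩
  have e : (ContinuousLinearMap.restrictScalars ℝ (ContinuousLinearMap.toSpanSingleton ℂ
      (-(((r + 1 : ℕ) : ℂ) * id ((‖z‖ : ℂ) ^ 2) ^ (r + 1 - 1) * 1) /
        (id ((‖z‖ : ℂ) ^ 2) ^ (r + 1)) ^ 2))).comp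
      (∑ i, (z i • dzbar i + conj (z i) • dz i)) =
      (-((r + 1) / ((‖z‖ : ℂ) ^ 2) ^ (r + 2))) • (∑ i, (z i • dzbar i + conj (z i) • dz i)) := by
    ext w
    simp only [ContinuousLinearMap.comp_apply, ContinuousLinearMap.coe_restrictScalars',
      ContinuousLinearMap.toSpanSingleton_apply, smul_apply, smul_eq_mul, id, Nat.add_sub_cancel]
    push_cast
    field_simp
    ring
  rw [antilinearPart_add, antilinearPart_smul, antilinearPart_smul, antilinearPart_eq_zero]
  refine Eq.trans (congrArg (fun L => h z • antilinearPart L + _) e) ?_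
  rw [antilinearPart_smul, antilinearPart_fderiv_norm_sq]
  ext w
  simp only [smul_apply, add_apply, smul_eq_mul, zero_apply]
  ring

lemma antilinearPart_smulRight {E F : Type*} [NormedAddCommGroup E] [NormedSpace ℂ E]
    [NormedAddCommGroup F] [NormedSpace ℂ F] (L : E →L[ℝ] ℂ) (x : F) :
    antilinearPart (L.smulRight x) = (antilinearPart L).smulRight x := by
  ext v
  simp only [antilinearPart_apply, ContinuousLinearMap.smulRight_apply, smul_eq_mul]
  module

/-- Product rule: y ↦ ι_y G is already conjugate-linear, so its ∂̄ is given by the Euler identity,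
and the other term is ∂̄g ∧ ι_z G. -/
lemma dbarAt_smul_contr {p q : ℕ} {g : Cn n → ℂ} {g' : Cn n →L[ℝ] ℂ} {z : Cn n}
    (hg : HasFDerivAt g g' z) {G : AltForm n (p + (q + 1))} (hG : IsOfType p (q + 1) G) :
    dbarAt (fun y => g y • contr (k := p + q) G y) z =
      (g z * (q + 1)) • G + wedgeOne (antilinearPart g') (contr (k := p + q) G z) := by
  have h1 : HasFDerivAt (fun y => g y • contr (k := p + q) G y)
      (g z • contr (k := p + q) G + g'.smulRight (contr (k := p + q) G z)) z :=
    hg.smul (contr (k := p + q) G).hasFDerivAt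
  rw [dbarAt, h1.fderiv, antilinearPart_add, antilinearPart_smul, antilinearPart_smulRight,
    ContinuousAlternatingMap.alternatizeUncurryFin_add,
    ContinuousAlternatingMap.alternatizeUncurryFin_smul]
  have e : antilinearPart (contr (k := p + q) G) = contr (k := p + q) G :=
    antilinearPart_antilinearPart _
  rw [e, alternatizeUncurryFin_contr hG, smul_smul]
  rfl

/-- The basic formula for `∂̄` of the kernels. -/
lemma dbarAt_div_smul_contr {k b : ℕ} (hk : b + 1 + k = n) {z : Cn n} (hz : z ≠ 0) {h : Cn n → ℂ}
    (hh : DifferentiableAt ℂ h z) (v : Fin k → Cn n) :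
    dbarAt (fun y => (h y / ((‖y‖ : ℂ) ^ 2) ^ (b + 1)) •
      contr (k := n + b) (iterContr k (b + 1) hk v) y) z =
      ((b + 1) * h z / ((‖z‖ : ℂ) ^ 2) ^ (b + 2)) •
        contr (k := n + b + 1) (wedgeOne (dbarNormSq z) (iterContr k (b + 1) hk v)) z := by
  obtain ⟨g', hg, hg'⟩ := exists_hasFDerivAt_div_norm_pow hz hh b
  have hρ : (‖z‖ : ℂ) ^ 2 ≠ 0 :=
    pow_ne_zero _ (Complex.ofReal_ne_zero.2 (norm_ne_zero_iff.2 hz))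
  rw [dbarAt_smul_contr hg (isOfType_iterContr k (b + 1) hk v), hg']
  -- The right side becomes ρ G − ∂̄ρ ∧ ι_z G. Its first term is the Euler contribution, its second
  -- comes from differentiating the power of ρ = ‖z‖².
  refine Eq.trans ?_ (congrArg (fun G : AltForm n (n + b + 1) => (_ : ℂ) • G)
    (contr_wedgeOne (dbarNormSq_I_smul z) (k := n + b) _ z).symm)
  rw [dbarNormSq_self]
  ext w
  change (h z / ((‖z‖ : ℂ) ^ 2) ^ (b + 1) * (b + 1)) * iterContr k (b + 1) hk v w +
      wedgeOne _ (contr (k := n + b) (iterContr k (b + 1) hk v) z) w =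
    ((b + 1) * h z / ((‖z‖ : ℂ) ^ 2) ^ (b + 2)) * ((‖z‖ : ℂ) ^ 2 * iterContr k (b + 1) hk v w -
      wedgeOne (dbarNormSq z) (contr (k := n + b) (iterContr k (b + 1) hk v) z) w)
  rw [wedgeOne_apply, wedgeOne_apply, mul_sub, sub_eq_add_neg, Finset.mul_sum,
    ← Finset.sum_neg_distrib]
  congr 1
  · field_simp
    ring
  · refine Finset.sum_congr rfl fun i _ => ?_
    rw [smul_apply, smul_eq_mul]
    ring

/-- The kernels `(∏_j z_{α j})⁻¹ ‖z‖^(-2(b + 1)) ι_{z̄} ι_{α 0} … ι_{α (k - 1)} (dz̄ ∧ dz)`.  For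
`k = 0` this is a multiple of the Bochner–Martinelli form. -/
def kernelValue {k b : ℕ} (h : b + 1 + k = n) (α : Fin k → Fin n) (z : Cn n) : AltForm n (n + b) :=
  ((∏ j, z (α j))⁻¹ / ((‖z‖ : ℂ) ^ 2) ^ (b + 1)) •
    contr (k := n + b) (iterContr k (b + 1) h fun j => stdVec (α j)) z

lemma isOfType_kernelValue {k b : ℕ} (h : b + 1 + k = n) (α : Fin k → Fin n) (z : Cn n) :
    IsOfType n b (kernelValue h α z) :=
  ((isOfType_iterContr k (b + 1) h _).contr z).smul _

lemma contDiffOn_kernelValue {k b : ℕ} (h : b + 1 + k = n) (α : Fin k → Fin n) {U : Set (Cn n)}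
    (hU : ∀ z ∈ U, z ≠ 0) (hα : ∀ z ∈ U, ∀ j, z (α j) ≠ 0) :
    ContDiffOn ℝ ∞ (kernelValue h α) U := by
  unfold kernelValue
  refine ContDiffOn.fun_smul ?_ (contr (k := n + b) _).contDiff.contDiffOn
  have h1 : ContDiffOn ℝ ∞ (fun z : Cn n => ∏ j, z (α j)) U :=
    contDiffOn_prod fun j _ => (dz (α j)).contDiff.contDiffOn
  have h2 : ContDiffOn ℝ ∞ (fun z : Cn n => ((‖z‖ : ℂ) ^ 2) ^ (b + 1)) U :=
    ((Complex.ofRealCLM.contDiff.comp_contDiffOn (contDiffOn_id.norm ℝ hU)).pow 2).pow (b + 1)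
  simp only [div_eq_mul_inv _ (((_ : ℂ) ^ 2) ^ (b + 1))]
  refine (h1.inv fun z hz => Finset.prod_ne_zero_iff.2 fun j _ => hα z hz j).mul (h2.inv fun z hz => ?_)
  exact pow_ne_zero _ (pow_ne_zero _ (Complex.ofReal_ne_zero.2 (norm_ne_zero_iff.2 (hU z hz))))

lemma dbarAt_kernelValue {k b : ℕ} (h : b + 1 + k = n) (α : Fin k → Fin n) {z : Cn n}
    (hz : z ≠ 0) (hα : ∀ j, z (α j) ≠ 0) :
    dbarAt (kernelValue h α) z = ((b + 1) * (∏ j, z (α j))⁻¹ / ((‖z‖ : ℂ) ^ 2) ^ (b + 2)) •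
        contr (k := n + b + 1) (wedgeOne (dbarNormSq z)
          (iterContr k (b + 1) h fun j => stdVec (α j))) z := by
  refine dbarAt_div_smul_contr h hz (h := fun y => (∏ j, y (α j))⁻¹) ?_ _
  have h1 : DifferentiableAt ℂ (fun y : Cn n => ∏ j, y (α j)) z :=
    (contDiff_prod (n := 1) fun j _ =>
      (EuclideanSpace.proj (α j) : Cn n →L[ℂ] ℂ).contDiff).differentiable one_ne_zero z
  exact h1.fun_inv (Finset.prod_ne_zero_iff.2 fun j _ => hα j)

/-- With no indices the form inside is vol, and ∂̄ρ ∧ vol = 0 by degree. This is the closedness of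
the Bochner–Martinelli form. -/
lemma dbarAt_kernelValue_zero {b : ℕ} (h : b + 1 + 0 = n) (α : Fin 0 → Fin n) {z : Cn n}
    (hz : z ≠ 0) : dbarAt (kernelValue h α) z = 0 := by
  rw [dbarAt_kernelValue h α hz fun j => j.elim0,
    AltForm.eq_zero_of_lt (by omega) (wedgeOne _ _), contr_zero]
  ext w
  simp

/-- The kernels form a tower under `∂̄` and the Čech differential. -/
lemma dbarAt_kernelValue_succ {k b : ℕ} (h : b + 1 + (k + 1) = n) (α : Fin (k + 1) → Fin n)
    {z : Cn n} (hz : z ≠ 0) (hα : ∀ j, z (α j) ≠ 0) :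
    dbarAt (kernelValue h α) z = ∑ j : Fin (k + 1), ((b + 1) * (-1) ^ (j : ℕ) : ℂ) •
      kernelValue (k := k) (b := b + 1) (by omega) (α ∘ j.succAbove) z := by
  rw [dbarAt_kernelValue h α hz hα, wedgeOne_iterContr (dbarNormSq_I_smul z)]
  refine Eq.trans (congrArg (fun L : Cn n →L[ℝ] AltForm n (n + b + 1) => (_ : ℂ) • L z)
    (contr_sum (k := n + b + 1) _ _)) ?_
  rw [sum_apply, Finset.smul_sum]
  refine Finset.sum_congr rfl fun j _ => ?_
  refine Eq.trans (congrArg (fun L : Cn n →L[ℝ] AltForm n (n + b + 1) => (_ : ℂ) • L z)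
    (contr_smul (k := n + b + 1) _ _)) ?_
  rw [smul_apply, smul_smul, dbarNormSq_stdVec, kernelValue]
  refine Eq.trans ?_ (smul_smul _ _ _).symm
  congr 1
  -- The coefficient ∂̄ρ(e_{α j}) = z_{α j} cancels exactly the factor of the denominator that
  -- belongs to the omitted index.
  rw [Fin.prod_univ_succAbove _ j]
  have := hα j
  simp only [Function.comp_apply]
  field_simp

/-- The top of the tower of kernels. -/
lemma sum_kernelValue {m : ℕ} (α : Fin (m + 1) → Fin (m + 1)) {z : Cn (m + 1)} (hz : z ≠ 0)
    (hα : ∀ j, z (α j) ≠ 0) :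
    ∑ j : Fin (m + 1), ((-1) ^ (j : ℕ) : ℂ) •
      kernelValue (k := m) (b := 0) (by omega) (α ∘ j.succAbove) z =
      (∏ j, z (α j))⁻¹ • iterContr (m + 1) 0 (zero_add _) (fun j => stdVec (α j)) := by
  have hρ : (‖z‖ : ℂ) ^ 2 ≠ 0 :=
    pow_ne_zero _ (Complex.ofReal_ne_zero.2 (norm_ne_zero_iff.2 hz))
  -- Taking u = z and τ = ∂̄ρ, the factor τ u is ρ itself and cancels the remaining denominator
  -- ‖z‖².
  have h1 := sum_contr_iterContr_stdVec (dbarNormSq_I_smul z) α z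
  rw [dbarNormSq_self] at h1
  have h2 := congrArg (fun G : AltForm (m + 1) (m + 1) =>
    ((∏ j, z (α j))⁻¹ / (‖z‖ : ℂ) ^ 2) • G) h1
  rw [smul_smul, div_mul_cancel₀ _ hρ, Finset.smul_sum] at h2
  refine Eq.trans (Finset.sum_congr rfl fun j _ => ?_) h2
  rw [kernelValue, dbarNormSq_stdVec]
  refine (smul_smul _ _ _).trans (Eq.trans ?_ (smul_smul _ _ _).symm)
  congr 1
  rw [Fin.prod_univ_succAbove _ j]
  have := hα j
  simp only [Function.comp_apply, zero_add, pow_one]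
  field_simp

/-- Contracting vol with z reproduces term by term the numerator ∑ ± z̄_i dz̄_1 ∧ … (dz̄_i omitted)
… ∧ dz_n. -/
lemma bmValue_eq (m : ℕ) (z : Cn (m + 1)) (α : Fin 0 → Fin (m + 1)) :
    bmValue m z = ((-1) ^ ((m + 1) * m / 2) * (m.factorial : ℂ) /
      (2 * Real.pi * Complex.I) ^ (m + 1)) • kernelValue (k := 0) (b := m) rfl α z := by
  rw [bmValue, kernelValue, smul_smul]
  congr 1
  · rw [Finset.univ_eq_empty, Finset.prod_empty, inv_one, mul_one_div, pow_mul]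
  · exact (contr_dzbarDz _ z).symm

end Kernels

/-! ### Comparison of the Bochner–Martinelli and the Cauchy cocycle -/

section Comparison

lemma coe_inter_coordCover {n a : ℕ} {α : Fin (a + 1) → Fin n} {z : Cn n}
    (hz : z ∈ inter (coordCover n) α) (j : Fin (a + 1)) : z (α j) ≠ 0 :=
  Set.mem_iInter.1 hz j

lemma ne_zero_of_mem_inter {n a : ℕ} {α : Fin (a + 1) → Fin n} {z : Cn n}
    (hz : z ∈ inter (coordCover n) α) : z ≠ 0 := by
  rintro rfl
  exact coe_inter_coordCover hz 0 rfl

/-- The kernels as smooth forms of type `(n, b)` on the intersections of the covering. -/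
def kernelForm {n a b : ℕ} (h : b + 1 + (a + 1) = n) (α : Fin (a + 1) → Fin n) :
    Forms (inter (coordCover n) α) n b :=
  .mk (kernelValue h α) (by
    refine ⟨contDiffOn_kernelValue h α (fun z hz => ne_zero_of_mem_inter hz)
      fun z hz => coe_inter_coordCover hz, isOfType_kernelValue h α, fun z hz => ?_⟩
    obtain ⟨j, hj⟩ : ∃ j, z (α j) = 0 := by
      by_contra h
      push Not at h
      exact hz (Set.mem_iInter.2 h)
    -- Since 0⁻¹ = 0, the formula itself vanishes off the intersection, as extension by zero
    -- requires.
    have : ∏ j, z (α j) = 0 := Finset.prod_eq_zero (Finset.mem_univ j) hj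
    ext w
    simp [kernelValue, this])

/-! ### Components of the canonical cochain maps and pointwise values of the Čech differential -/

section

variable {n : ℕ} {ι : Type*} {W : ι → Opens (Cn n)} {X : Opens (Cn n)}

lemma formToCD_zero (hW : iSup W = X) (p q : ℕ) (η : Forms X p q) (α : Fin 1 → ι) :
    formToCD hW p q η ⟨(0, q), zero_add q⟩ α = restrict (inter_le_of_le (a := 0) hW α) p q η := by
  rw [formToCD, LinearMap.comp_apply, LinearMap.single_apply, Pi.single_eq_same]
  rfl

lemma formToCD_succ (hW : iSup W = X) (p q : ℕ) (η : Forms X p q) (a b : ℕ) (h : a + 1 + b = q) :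
    formToCD hW p q η ⟨(a + 1, b), h⟩ = 0 := by
  rw [formToCD, LinearMap.comp_apply, LinearMap.single_apply]
  exact Pi.single_eq_of_ne (fun e => by simpa using congrArg (fun x => x.1.1) e) _

lemma holToCD_zero (p q : ℕ) (σ : HolCochain W p q) :
    holToCD W p q σ ⟨(q, 0), add_zero q⟩ = σ.1 := by
  rw [holToCD, LinearMap.comp_apply, LinearMap.single_apply, Pi.single_eq_same]
  rfl

lemma holToCD_succ (p q : ℕ) (σ : HolCochain W p q) (a b : ℕ) (h : a + (b + 1) = q) :
    holToCD W p q σ ⟨(a, b + 1), h⟩ = 0 := by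
  rw [holToCD, LinearMap.comp_apply, LinearMap.single_apply]
  exact Pi.single_eq_of_ne (fun e => by simpa using congrArg (fun x => x.1.2) e) _

lemma Forms.val_sum {U : Opens (Cn n)} {p q : ℕ} {κ : Type*} (s : Finset κ)
    (f : κ → Forms U p q) (z : Cn n) : (∑ i ∈ s, f i).val z = ∑ i ∈ s, (f i).val z := by
  classical
  induction s using Finset.induction_on with
  | empty => simp
  | insert i s hi ih => rw [Finset.sum_insert hi, Finset.sum_insert hi, ← ih]; rfl

lemma cechDiff_val (p q a : ℕ) (σ : CechCochain W p q a) (α : Fin (a + 2) → ι) {z : Cn n}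
    (hz : z ∈ inter W α) : (cechDiff W p q a σ α).val z =
      ∑ ν : Fin (a + 2), (-1 : ℂ) ^ (ν : ℕ) • (σ (α ∘ ν.succAbove)).val z := by
  have h : cechDiff W p q a σ α = ∑ ν : Fin (a + 2), (-1 : ℂ) ^ (ν : ℕ) •
      restrict (inter_le_comp W α ν.succAbove) p q (σ (α ∘ ν.succAbove)) := by
    simp [cechDiff]
  rw [h, Forms.val_sum]
  refine Finset.sum_congr rfl fun ν _ => ?_
  rw [Forms.val_smul, Pi.smul_apply, restrict_apply_of_mem _ _ _ _ hz]

end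

/-- The constant `(2 π i)^(-n)`, `n = m + 1`. -/
def cauchyConst (m : ℕ) : ℂ := (1 / (2 * Real.pi * Complex.I)) ^ (m + 1)

lemma neg_one_pow_mul_neg_one_pow (e : ℕ) : (-1 : ℂ) ^ e * (-1) ^ e = 1 := by
  rw [← mul_pow]; simp

/-- Iterated contraction carries the same permutation sign as the alternating cochain, and both
vanish on tuples with repetition. This removes the case distinction on α; the explicit power of -1
undoes the sign of the contraction. -/
lemma cauchyCochain_val (m : ℕ) (α : Fin (m + 1) → Fin (m + 1)) (z : Cn (m + 1)) :
    ((cauchyCochain m).1 α).val z =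
      ((-1) ^ ((m + 1) * m / 2) * cauchyConst m * (∏ j, z (α j))⁻¹ : ℂ) •
        iterContr (m + 1) 0 (zero_add _) (fun j => stdVec (α j)) := by
  by_cases hα : Function.Bijective α
  · have h1 : (cauchyCochain m).1 α =
        ((Equiv.Perm.sign (Equiv.ofBijective α hα) : ℤ) : ℂ) • cauchyForm m α hα := dif_pos hα
    rw [h1, iterContr_stdVec_comp α hα]
    have h2 : ∏ j, z (α j) = ∏ j, z j := Equiv.prod_comp (Equiv.ofBijective α hα) fun j => z j
    change ((Equiv.Perm.sign (Equiv.ofBijective α hα) : ℤ) : ℂ) • cauchyValue m z = _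
    rw [cauchyValue, h2, smul_smul, smul_smul]
    congr 1
    rw [cauchyConst]
    linear_combination (-(Equiv.Perm.sign (Equiv.ofBijective α hα) : ℤ) *
      (1 / (2 * Real.pi * Complex.I)) ^ (m + 1) * (∏ j, z j)⁻¹ : ℂ) *
        neg_one_pow_mul_neg_one_pow ((m + 1) * m / 2)
  · have h1 : (cauchyCochain m).1 α = 0 := dif_neg hα
    have : ¬ Function.Injective α := fun h => hα (Finite.injective_iff_bijective.1 h)
    simp only [Function.Injective, not_forall] at this
    obtain ⟨i, j, hij, hne⟩ := this
    rw [h1, iterContr_eq_zero _ _ _ _ hne (show stdVec (α i) = stdVec (α j) by rw [hij])]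
    ext w
    simp

/-- After clearing denominators the claim is ∑_ν (-1)^ν z_{α ν} ι_{α without ν} vol = 0 for n + 1
indices. -/
lemma holDiff_cauchyCochain (m : ℕ) :
    holDiff (coordCover (m + 1)) (m + 1) m (cauchyCochain m) = 0 := by
  refine Subtype.ext (funext fun α => Forms.ext_of_mem fun z hz => ?_)
  refine (cechDiff_val (m + 1) 0 m (cauchyCochain m).1 α hz).trans ?_
  -- The contracting vector is the basis vector of the first index: the right side of this identity
  -- is then the term ν = 0, and its left side collects the terms ν > 0 up to sign.
  have h1 := sum_contr_iterContr_stdVec (dbarNormSq_I_smul z) (Fin.tail α) (stdVec (α 0))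
  have h2 : ∑ ν : Fin (m + 2), ((-1) ^ (ν : ℕ) * dbarNormSq z (stdVec (α ν)) : ℂ) •
      iterContr (m + 1) 0 (zero_add _) (fun j => stdVec (α (ν.succAbove j))) = 0 := by
    rw [Fin.sum_univ_succ]
    have e : ∀ j : Fin (m + 1), ((-1) ^ ((j.succ : Fin (m + 2)) : ℕ) *
        dbarNormSq z (stdVec (α j.succ)) : ℂ) •
        iterContr (m + 1) 0 (zero_add _) (fun i => stdVec (α (j.succ.succAbove i))) =
        -(((-1) ^ (j : ℕ) * dbarNormSq z (stdVec (Fin.tail α j)) : ℂ) •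
          contr (k := m + 1) (iterContr m 1 (by omega)
            (fun i => stdVec (Fin.tail α (j.succAbove i)))) (stdVec (α 0))) := fun j => by
      rw [iterContr_succ]
      have e1 : (Fin.tail fun i : Fin (m + 1) => (stdVec (α (j.succ.succAbove i)) : Cn (m + 1))) =
          fun i => stdVec (Fin.tail α (j.succAbove i)) := by
        funext i
        simp only [Fin.tail, Fin.succ_succAbove_succ]
      rw [e1, Fin.succ_succAbove_zero, Fin.val_succ, pow_succ]
      ext w
      simp only [ContinuousAlternatingMap.smul_apply, ContinuousAlternatingMap.neg_apply,
        smul_eq_mul, Fin.tail]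
      change _ * (_ : ℂ) = -(_ * _)
      ring
    rw [Finset.sum_congr rfl fun j _ => e j, Finset.sum_neg_distrib]
    refine Eq.trans (congrArg (fun G => _ + -G) h1) ?_
    rw [Fin.val_zero, pow_zero, one_mul]
    exact add_neg_cancel _
  have hz' := coe_inter_coordCover hz
  have h3 := congrArg (fun G : AltForm (m + 1) (m + 1) => ((-1) ^ ((m + 1) * m / 2) *
    cauchyConst m * (∏ j, z (α j))⁻¹ : ℂ) • G) h2
  rw [Finset.smul_sum] at h3
  refine (Finset.sum_congr rfl fun ν _ => ?_).trans (h3.trans ?_)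
  · rw [cauchyCochain_val]
    refine (smul_smul _ _ _).trans (Eq.trans ?_ (smul_smul _ _ _).symm)
    congr 1
    rw [Fin.prod_univ_succAbove _ ν, dbarNormSq_stdVec]
    have := hz' ν
    simp only [Function.comp_apply]
    field_simp
  · ext w
    simp

lemma bochnerMartinelli_val (m : ℕ) (α : Fin 0 → Fin (m + 1)) (z : Cn (m + 1)) :
    (bochnerMartinelli m).val z = ((-1) ^ ((m + 1) * m / 2) * cauchyConst m * m.factorial : ℂ) •
      kernelValue (k := 0) (b := m) rfl α z := by
  refine (bmValue_eq m z α).trans ?_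
  congr 1
  rw [cauchyConst, one_div, inv_pow]
  ring

lemma dbar_bochnerMartinelli (m : ℕ) :
    dbar (punctured (m + 1)) (m + 1) m (bochnerMartinelli m) = 0 := by
  refine Forms.ext_of_mem fun z hz => ?_
  rw [dbar_apply_of_mem _ _ _ hz]
  have h1 : (bochnerMartinelli m).val =
      ((-1) ^ ((m + 1) * m / 2) * cauchyConst m * m.factorial : ℂ) •
        kernelValue (k := 0) (b := m) rfl Fin.elim0 := funext fun z => bochnerMartinelli_val m _ z
  have h2 := contDiffOn_kernelValue (k := 0) (b := m) rfl (Fin.elim0 : Fin 0 → Fin (m + 1))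
    (U := punctured (m + 1)) (fun z hz => hz) fun z _ j => j.elim0
  rw [h1, dbarAt_smul _ ((h2.contDiffAt ((punctured (m + 1)).isOpen.mem_nhds hz)).differentiableAt
    (by simp)), dbarAt_kernelValue_zero _ _ hz]
  ext w
  simp

end Comparison

/-! ### The interpolating cochain and its coboundary -/

section Coboundary

/-- The coefficients of the interpolating cochain. -/
def interpCoeff (m a b : ℕ) : ℂ :=
  -((-1) ^ ((m + 2) * (m + 1) / 2) * cauchyConst (m + 1) * (-1) ^ (∑ i ∈ Finset.range (a + 2), i) *
    b.factorial)

/-- The Čech–Dolbeault cochain whose coboundary is the difference of the Bochner–Martinelli and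
the Cauchy cocycle on `ℂⁿ ∖ 0`, `n = m + 2`. -/
def interpCochain (m : ℕ) : CDCochain (coordCover (m + 2)) (m + 2) m := fun ab α =>
  interpCoeff m ab.1.1 ab.1.2 • kernelForm (by have := ab.2; omega) α

lemma dbarAt_kernelForm {n a b : ℕ} (h : b + 1 + (a + 1) = n) (α : Fin (a + 1) → Fin n)
    {z : Cn n} (hz : z ∈ inter (coordCover n) α) (c : ℂ) :
    (dbar _ n b (c • kernelForm h α)).val z =
      ∑ j : Fin (a + 1), (c * ((b + 1) * (-1) ^ (j : ℕ)) : ℂ) •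
        kernelValue (k := a) (b := b + 1) (by omega) (α ∘ j.succAbove) z := by
  rw [map_smul, Forms.val_smul, Pi.smul_apply, dbar_apply_of_mem _ _ _ hz]
  refine Eq.trans (congrArg (fun G : AltForm n (n + b + 1) => c • G)
    (dbarAt_kernelValue_succ h α (ne_zero_of_mem_inter hz) (coe_inter_coordCover hz))) ?_
  rw [Finset.smul_sum]
  exact Finset.sum_congr rfl fun j _ => smul_smul _ _ _

lemma cdDiff_interpCochain (m : ℕ) :
    cdDiff (coordCover (m + 2)) (m + 2) m (interpCochain m) =
      formToCD (iSup_coordCover (m + 2)) (m + 2) (m + 1) (bochnerMartinelli (m + 1)) -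
        (-1 : ℂ) ^ ((m + 2) * (m + 1) / 2) •
          holToCD (coordCover (m + 2)) (m + 2) (m + 1) (cauchyCochain (m + 1)) := by
  funext ⟨⟨a, b⟩, h⟩
  funext α
  refine Forms.ext_of_mem fun z hz => ?_
  change (cdCechPart (coordCover (m + 2)) (m + 2) m a b h (interpCochain m) α +
    (-1 : ℂ) ^ a • cdDbarPart (coordCover (m + 2)) (m + 2) m a b h (interpCochain m) α).val z =
      (formToCD (iSup_coordCover (m + 2)) (m + 2) (m + 1) (bochnerMartinelli (m + 1)) ⟨(a, b), h⟩ α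
        - (-1 : ℂ) ^ ((m + 2) * (m + 1) / 2) •
          holToCD (coordCover (m + 2)) (m + 2) (m + 1) (cauchyCochain (m + 1)) ⟨(a, b), h⟩ α).val z
  -- At the end a = 0 only ∂̄ contributes and gives the Bochner–Martinelli form. In the interior the
  -- two parts cancel. At the end b = 0 only the Čech part contributes and gives the Cauchy cochain.
  match a, b, h with
  | 0, b + 1, h =>
    obtain rfl : b = m := by simpa using h
    have e1 : holToCD (coordCover (b + 2)) (b + 2) (b + 1) (cauchyCochain (b + 1))
        ⟨(0, b + 1), h⟩ = 0 := holToCD_succ _ _ _ _ _ _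
    have e2 : formToCD (iSup_coordCover (b + 2)) (b + 2) (b + 1) (bochnerMartinelli (b + 1))
        ⟨(0, b + 1), h⟩ α = restrict (inter_le_of_le (a := 0) (iSup_coordCover (b + 2)) α)
          (b + 2) (b + 1) (bochnerMartinelli (b + 1)) := formToCD_zero _ _ _ _ _
    rw [e1, e2, Pi.zero_apply, smul_zero, sub_zero, restrict_apply_of_mem _ _ _ _ hz, pow_zero,
      one_smul]
    change ((0 : Forms (inter (coordCover (b + 2)) α) (b + 2) (b + 1)) +
      dbar _ (b + 2) b (interpCoeff b 0 b • kernelForm _ α)).val z = _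
    rw [zero_add, dbarAt_kernelForm _ α hz, Fin.sum_univ_one]
    refine Eq.trans ?_ (bochnerMartinelli_val (b + 1) (α ∘ Fin.succAbove 0) z).symm
    congr 1
    -- The coefficient of bidegree (0, b) contains b!, and ∂̄ contributes b + 1, which yields the (n
    -- - 1)! of C_n, with n = b + 2.
    rw [interpCoeff]
    simp [Finset.sum_range_succ, Nat.factorial_succ]
    ring
  | a + 1, b + 1, h =>
    have e1 : holToCD (coordCover (m + 2)) (m + 2) (m + 1) (cauchyCochain (m + 1))
        ⟨(a + 1, b + 1), h⟩ = 0 := holToCD_succ _ _ _ _ _ _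
    have e2 : formToCD (iSup_coordCover (m + 2)) (m + 2) (m + 1) (bochnerMartinelli (m + 1))
        ⟨(a + 1, b + 1), h⟩ = 0 := formToCD_succ _ _ _ _ _ _ _
    rw [e1, e2]
    change _ = ((0 : Forms (inter (coordCover (m + 2)) α) (m + 2) (b + 1)) -
      (-1 : ℂ) ^ ((m + 2) * (m + 1) / 2) • 0).val z
    rw [smul_zero, sub_zero]
    have hab : b + 1 + (a + 1 + 1) = m + 2 := by omega
    have e3 := cechDiff_val (m + 2) (b + 1) a (fun α => interpCoeff m a (b + 1) •
      kernelForm (n := m + 2) (by omega) α) α hz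
    change (cechDiff _ (m + 2) (b + 1) a (fun α => interpCoeff m a (b + 1) •
      kernelForm (n := m + 2) _ α) α).val z + (-1 : ℂ) ^ (a + 1) •
        (dbar _ (m + 2) b (interpCoeff m (a + 1) b • kernelForm hab α)).val z = 0
    rw [e3, dbarAt_kernelForm _ α hz, Finset.smul_sum, ← Finset.sum_add_distrib]
    refine Finset.sum_eq_zero fun j _ => ?_
    ext w
    change (-1 : ℂ) ^ (j : ℕ) * (interpCoeff m a (b + 1) *
      kernelValue (n := m + 2) (k := a + 1) (b := b + 1) _ (α ∘ j.succAbove) z w) +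
      (-1 : ℂ) ^ (a + 1) * ((interpCoeff m (a + 1) b * ((b + 1) * (-1) ^ (j : ℕ))) *
        kernelValue (n := m + 2) (k := a + 1) (b := b + 1) _ (α ∘ j.succAbove) z w) = 0
    -- Cancellation in bidegree (a + 1, b + 1) is equivalent to this recursion. It forces the
    -- factorials and the triangular sign exponents in the coefficients.
    have e4 : interpCoeff m a (b + 1) = -((-1) ^ (a + 1) * interpCoeff m (a + 1) b * (b + 1)) := by
      have h1 : (-1 : ℂ) ^ (a + 1) * (-1) ^ (∑ i ∈ Finset.range (a + 1 + 2), i) =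
          -(-1) ^ (∑ i ∈ Finset.range (a + 2), i) := by
        rw [Finset.sum_range_succ _ (a + 2), pow_add]
        linear_combination (-(-1) ^ (∑ i ∈ Finset.range (a + 2), i) : ℂ) *
          neg_one_pow_mul_neg_one_pow (a + 1)
      rw [interpCoeff, interpCoeff, Nat.factorial_succ]
      push_cast
      linear_combination (-((-1) ^ ((m + 2) * (m + 1) / 2) * cauchyConst (m + 1) *
        b.factorial * (b + 1)) : ℂ) * h1
    rw [e4]
    ring
  | a + 1, 0, h =>
    obtain rfl : a = m := by simpa using h
    have e1 : holToCD (coordCover (a + 2)) (a + 2) (a + 1) (cauchyCochain (a + 1))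
        ⟨(a + 1, 0), h⟩ α = (cauchyCochain (a + 1)).1 α := congrFun (holToCD_zero _ _ _) α
    have e2 : formToCD (iSup_coordCover (a + 2)) (a + 2) (a + 1) (bochnerMartinelli (a + 1))
        ⟨(a + 1, 0), h⟩ = 0 := formToCD_succ _ _ _ _ _ _ _
    have e3 := cechDiff_val (a + 2) 0 a (fun α => interpCoeff a a 0 •
      kernelForm (n := a + 2) (by omega) α) α hz
    rw [e1, e2, Pi.zero_apply, zero_sub]
    change (cechDiff _ (a + 2) 0 a (fun α => interpCoeff a a 0 •
      kernelForm (n := a + 2) _ α) α).val z + (-1 : ℂ) ^ (a + 1) • (0 : AltForm (a + 2) (a + 2)) =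
        -((-1 : ℂ) ^ ((a + 2) * (a + 1) / 2) • ((cauchyCochain (a + 1)).1 α).val z)
    have e0 : (-1 : ℂ) ^ (a + 1) • (0 : AltForm (a + 2) (a + 2)) = 0 := by
      ext w
      simp
    rw [e3, cauchyCochain_val, e0]
    refine (add_zero _).trans ?_
    have e4 := sum_kernelValue α (ne_zero_of_mem_inter hz) (coe_inter_coordCover hz)
    have e5 := congrArg (fun G : AltForm (a + 2) (a + 2) => interpCoeff a a 0 • G) e4
    rw [Finset.smul_sum] at e5
    refine (Finset.sum_congr rfl fun j _ => ?_).trans (e5.trans ?_)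
    · ext w
      exact mul_left_comm ((-1 : ℂ) ^ (j : ℕ)) (interpCoeff a a 0) _
    -- At the end of the tower the accumulated sign exponent is again n(n-1)/2, so it cancels the
    -- sign of C_n.
    · have h1 : interpCoeff a a 0 = -cauchyConst (a + 1) := by
        rw [interpCoeff, Finset.sum_range_id, Nat.factorial_zero]
        have := neg_one_pow_mul_neg_one_pow ((a + 2) * (a + 1) / 2)
        push_cast
        linear_combination (-cauchyConst (a + 1)) * this
      rw [h1]
      ext w
      change -cauchyConst (a + 1) * (_ * (_ : ℂ)) = -(_ * (_ * _))
      have := neg_one_pow_mul_neg_one_pow ((a + 2) * (a + 1) / 2)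
      linear_combination (cauchyConst (a + 1) * (∏ j, z (α j))⁻¹ *
        iterContr (a + 2) 0 (zero_add _) (fun j => stdVec (α j)) w) * this

/-- For n ≥ 2 the interpolating cochain is a primitive. For n = 1 the only coboundary in degree 0 is
zero, so the two cocycles must be equal; this is the top identity `sum_kernelValue` with a single
index. -/
lemma formToCD_sub_holToCD_mem (m : ℕ) :
    formToCD (iSup_coordCover (m + 1)) (m + 1) m (bochnerMartinelli m) -
        (-1 : ℂ) ^ ((m + 1) * m / 2) •
          holToCD (coordCover (m + 1)) (m + 1) m (cauchyCochain m) ∈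
      coboundaries (M := fun q => CDCochain (coordCover (m + 1)) (m + 1) q)
        (cdDiff (coordCover (m + 1)) (m + 1)) m := by
  cases m with
  | succ m => exact ⟨_, cdDiff_interpCochain m⟩
  | zero =>
    refine (Submodule.mem_bot ℂ).2 (sub_eq_zero.2 ?_)
    funext ⟨⟨a, b⟩, h⟩
    obtain ⟨rfl, rfl⟩ : a = 0 ∧ b = 0 := by simpa using h
    funext α
    refine Forms.ext_of_mem fun z hz => ?_
    refine Eq.trans (congrArg (fun η => Forms.val η z) (formToCD_zero _ _ _ _ _)) ?_
    rw [restrict_apply_of_mem _ _ _ _ hz, Pi.smul_apply, Pi.smul_apply, Forms.val_smul,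
      Pi.smul_apply]
    refine Eq.trans ?_ (congrArg (fun σ : CechCochain (coordCover 1) 1 0 0 =>
      (-1 : ℂ) ^ ((0 + 1) * 0 / 2) • (σ α).val z) (holToCD_zero _ _ _)).symm
    have e4 := sum_kernelValue (m := 0) α (ne_zero_of_mem_inter hz) (coe_inter_coordCover hz)
    rw [Fin.sum_univ_one] at e4
    change _ = (-1 : ℂ) ^ ((0 + 1) * 0 / 2) • ((cauchyCochain 0).1 α).val z
    rw [bochnerMartinelli_val 0 (α ∘ Fin.succAbove 0), cauchyCochain_val]
    ext w
    have e5 := congrArg (fun G : AltForm 1 1 => G w) e4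
    change (-1 : ℂ) ^ 0 * kernelValue _ _ z w = _ * _ at e5
    change _ * kernelValue _ _ z w = _ * (_ * _)
    rw [pow_zero, one_mul] at e5
    rw [e5]
    simp
    ring

end Coboundary

/-! ### Smooth forms on the punctured space: injectivity of the comparison map -/

/-! ### The identity ∂̄² = 0 -/

section DbarSquare

variable {E F : Type*} [NormedAddCommGroup E] [NormedSpace ℂ E] [NormedAddCommGroup F]
  [NormedSpace ℂ F]

/-- The conjugate-linear part as a continuous linear map. -/
def antilinearPartCLM : (E →L[ℝ] F) →L[ℝ] (E →L[ℝ] F) :=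
  (1 / 2 : ℂ) • (ContinuousLinearMap.id ℝ (E →L[ℝ] F) + Complex.I •
    (ContinuousLinearMap.compL ℝ E E F).flip (Complex.I • ContinuousLinearMap.id ℝ E))

/-- The conjugate-bilinear part of an `ℝ`-bilinear map. -/
def antilinearPart₂ (D : E →L[ℝ] E →L[ℝ] F) : E →L[ℝ] E →L[ℝ] F :=
  (1 / 2 : ℂ) • (antilinearPartCLM.comp D +
    Complex.I • (antilinearPartCLM.comp D).comp (Complex.I • ContinuousLinearMap.id ℝ E))

lemma antilinearPart₂_apply (D : E →L[ℝ] E →L[ℝ] F) (x : E) : antilinearPart₂ D x =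
    (1 / 2 : ℂ) • (antilinearPart (D x) + Complex.I • antilinearPart (D (Complex.I • x))) := rfl

lemma antilinearPart₂_symm {D : E →L[ℝ] E →L[ℝ] F} (hD : ∀ x y, D x y = D y x) (x y : E) :
    antilinearPart₂ D x y = antilinearPart₂ D y x := by
  simp only [antilinearPart_apply, antilinearPart₂_apply, smul_apply, add_apply]
  rw [hD y x, hD (Complex.I • y) x, hD y (Complex.I • x), hD (Complex.I • y) (Complex.I • x)]
  module

/-- Alternatization is ℂ-linear in the values, so it commutes with taking conjugate-linear parts in
the direction of differentiation. -/
lemma antilinearPart_alternatizeUncurryFinCLM_comp {n k : ℕ}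
    (D : Cn n →L[ℝ] Cn n →L[ℝ] AltForm n k) :
    antilinearPart ((ContinuousAlternatingMap.alternatizeUncurryFinCLM ℝ (Cn n) ℂ).comp
      (antilinearPartCLM.comp D)) =
      (ContinuousAlternatingMap.alternatizeUncurryFinCLM ℝ (Cn n) ℂ).comp (antilinearPart₂ D) := by
  refine ContinuousLinearMap.ext fun v => ?_
  rw [antilinearPart_apply]
  change (1 / 2 : ℂ) • (ContinuousAlternatingMap.alternatizeUncurryFin (antilinearPart (D v)) +
    Complex.I • ContinuousAlternatingMap.alternatizeUncurryFin
      (antilinearPart (D (Complex.I • v)))) =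
    ContinuousAlternatingMap.alternatizeUncurryFin
      ((1 / 2 : ℂ) • (antilinearPart (D v) + Complex.I • antilinearPart (D (Complex.I • v))))
  rw [ContinuousAlternatingMap.alternatizeUncurryFin_smul,
    ContinuousAlternatingMap.alternatizeUncurryFin_add,
    ContinuousAlternatingMap.alternatizeUncurryFin_smul]

lemma hasFDerivAt_dbarAt {n k : ℕ} {η : Cn n → AltForm n k} {z : Cn n}
    (h : DifferentiableAt ℝ (fderiv ℝ η) z) :
    HasFDerivAt (dbarAt η) ((ContinuousAlternatingMap.alternatizeUncurryFinCLM ℝ (Cn n) ℂ).comp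
      (antilinearPartCLM.comp (fderiv ℝ (fderiv ℝ η) z))) z :=
  (ContinuousAlternatingMap.alternatizeUncurryFinCLM ℝ (Cn n) ℂ).hasFDerivAt.comp z
    ((antilinearPartCLM (E := Cn n) (F := AltForm n k)).hasFDerivAt.comp z h.hasFDerivAt)

/-- The second derivative is symmetric, hence so is its conjugate-bilinear part, and alternating a
symmetric bilinear map gives zero. -/
lemma dbarAt_dbarAt {n k : ℕ} {η : Cn n → AltForm n k} {z : Cn n} (h : ContDiffAt ℝ ∞ η z) :
    dbarAt (dbarAt η) z = 0 := by
  have h2 : DifferentiableAt ℝ (fderiv ℝ η) z :=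
    (h.fderiv_right (m := 1) (by norm_cast)).differentiableAt one_ne_zero
  have hs : ∀ x y, fderiv ℝ (fderiv ℝ η) z x y = fderiv ℝ (fderiv ℝ η) z y x := fun x y =>
    (h.isSymmSndFDerivAt (by
      rw [minSmoothness_of_isRCLikeNormedField]
      exact WithTop.coe_le_coe.2 le_top)).eq x y
  rw [dbarAt, (hasFDerivAt_dbarAt h2).fderiv, antilinearPart_alternatizeUncurryFinCLM_comp]
  exact ContinuousAlternatingMap.alternatizeUncurryFin_alternatizeUncurryFinCLM_comp_of_symmetric
    (antilinearPart₂_symm hs)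

lemma dbar_dbar {n : ℕ} (U : Opens (Cn n)) (p q : ℕ) (η : Forms U p q) :
    dbar U p (q + 1) (dbar U p q η) = 0 := by
  refine Forms.ext_of_mem fun z hz => ?_
  rw [dbar_apply_of_mem _ _ _ hz]
  have h1 : (dbar U p q η).val =ᶠ[nhds z] dbarAt η.val :=
    Filter.eventually_of_mem (U.isOpen.mem_nhds hz) fun y hy => dbar_apply_of_mem p q η hy
  have h2 := dbarAt_dbarAt (η.contDiffOn.contDiffAt (U.isOpen.mem_nhds hz))
  rw [dbarAt] at h2 ⊢
  rw [h1.fderiv_eq]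
  exact h2

end DbarSquare

/-! ### An explicit partition of unity on the punctured space -/

section PartitionOfUnity

variable {n : ℕ}

/-- An unnormalized smooth partition of unity of the punctured space subordinate to the covering by
the sets `{z_i ≠ 0}`. -/
def bump (i : Fin n) (z : Cn n) : ℝ := expNegInvGlue (2 * n * ‖z i‖ ^ 2 - ‖z‖ ^ 2)

lemma contDiff_bump (i : Fin n) : ContDiff ℝ ∞ (bump i) := by
  refine expNegInvGlue.contDiff.comp (ContDiff.sub ?_ (contDiff_norm_sq ℝ))
  exact contDiff_const.mul ((dz i).contDiff.norm_sq ℝ)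

/-- At such a point the argument of the cutoff is -‖z‖² < 0, and it stays negative nearby. Vanishing
on a whole neighbourhood is what makes extension by zero smooth. -/
lemma bump_eventuallyEq_zero {i : Fin n} {z : Cn n} (hz : z ≠ 0) (hi : z i = 0) :
    ∀ᶠ y in nhds z, bump i y = 0 := by
  have hc : Continuous fun y : Cn n => 2 * n * ‖y i‖ ^ 2 - ‖y‖ ^ 2 := by fun_prop
  have h0 : 2 * n * ‖z i‖ ^ 2 - ‖z‖ ^ 2 < 0 := by
    have := norm_pos_iff.2 hz
    rw [hi, norm_zero]
    nlinarith
  filter_upwards [hc.continuousAt.eventually (gt_mem_nhds h0)] with y hy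
  exact expNegInvGlue.zero_of_nonpos hy.le

/-- If every term vanished, then 2n |z_i|² ≤ ‖z‖² for all i; summing gives 2n ‖z‖² ≤ n ‖z‖², which
is impossible. The factor 2n in the cutoff provides this slack. -/
lemma sum_bump_pos {z : Cn n} (hz : z ≠ 0) : 0 < ∑ i, bump i z := by
  refine Finset.sum_pos' (fun i _ => expNegInvGlue.nonneg _) ?_
  by_contra h
  push Not at h
  have h1 : ∀ i, 2 * n * ‖z i‖ ^ 2 ≤ ‖z‖ ^ 2 := fun i => by
    by_contra hi
    push Not at hi
    exact (h i (Finset.mem_univ i)).not_gt (expNegInvGlue.pos_of_pos (sub_pos.2 hi))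
  have h2 : ∑ i : Fin n, 2 * n * ‖z i‖ ^ 2 ≤ ∑ _i : Fin n, ‖z‖ ^ 2 :=
    Finset.sum_le_sum fun i _ => h1 i
  rw [← Finset.mul_sum, ← EuclideanSpace.norm_sq_eq, Finset.sum_const, Finset.card_univ,
    Fintype.card_fin, nsmul_eq_mul] at h2
  have hn : 0 < (n : ℝ) := by
    rcases Nat.eq_zero_or_pos n with rfl | hn
    · exact (hz (Subsingleton.elim _ _)).elim
    · exact_mod_cast hn
  have := norm_pos_iff.2 hz
  have : 0 < n * ‖z‖ ^ 2 := by positivity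
  linarith

/-- A smooth partition of unity of the punctured space subordinate to the covering by the sets
`{z_i ≠ 0}`. -/
def partitionFun (i : Fin n) (z : Cn n) : ℂ := ((bump i z / ∑ j, bump j z : ℝ) : ℂ)

lemma contDiffAt_partitionFun (i : Fin n) {z : Cn n} (hz : z ≠ 0) :
    ContDiffAt ℝ ∞ (partitionFun i) z := by
  refine Complex.ofRealCLM.contDiff.contDiffAt.comp z ?_
  exact (contDiff_bump i).contDiffAt.div
    (ContDiff.sum fun j _ => contDiff_bump j).contDiffAt (sum_bump_pos hz).ne'

lemma sum_partitionFun {z : Cn n} (hz : z ≠ 0) : ∑ i, partitionFun i z = 1 := by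
  simp only [partitionFun]
  rw [← Complex.ofReal_sum, ← Finset.sum_div, div_self (sum_bump_pos hz).ne', Complex.ofReal_one]

lemma partitionFun_eventuallyEq_zero {i : Fin n} {z : Cn n} (hz : z ≠ 0) (hi : z i = 0) :
    ∀ᶠ y in nhds z, partitionFun i y = 0 := by
  filter_upwards [bump_eventuallyEq_zero hz hi] with y hy
  simp [partitionFun, hy]

/-- The product of a form with a function of the partition of unity, extended by zero. -/
def mulExtend (i : Fin n) {U V : Opens (Cn n)} (hVU : V ≤ U) (hUV : ∀ z ∈ U, z i ≠ 0 → z ∈ V)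
    (hU : ∀ z ∈ U, z ≠ 0) {p q : ℕ} (η : Forms V p q) : Forms U p q :=
  .mk (fun z => partitionFun i z • η.val z) (by
    refine ⟨fun z hz => ContDiffAt.contDiffWithinAt ?_, fun z => (η.isOfType z).smul _,
      fun z hz => ?_⟩
    -- Where z_i = 0 the form η may be singular, but the cutoff vanishes near that point; elsewhere
    -- the point lies in V and both factors are smooth.
    · by_cases hi : z i = 0
      · refine (contDiffAt_const (c := 0)).congr_of_eventuallyEq ?_
        filter_upwards [partitionFun_eventuallyEq_zero (hU z hz) hi] with y hy
        ext w
        simp [hy]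
      · exact (contDiffAt_partitionFun i (hU z hz)).smul
          (η.contDiffOn.contDiffAt (V.isOpen.mem_nhds (hUV z hz hi)))
    · have h0 : η.val z = 0 := η.val_eq_zero fun h => hz (hVU h)
      ext w
      simp [h0])

lemma mulExtend_val (i : Fin n) {U V : Opens (Cn n)} (hVU : V ≤ U)
    (hUV : ∀ z ∈ U, z i ≠ 0 → z ∈ V) (hU : ∀ z ∈ U, z ≠ 0) {p q : ℕ} (η : Forms V p q) (z : Cn n) :
    (mulExtend i hVU hUV hU η).val z = partitionFun i z • η.val z := rfl

/-- Indices with z_i = 0 have weight zero, so the sum is a weighted average of the single value φ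
with total weight 1. -/
lemma sum_mulExtend_val {U : Opens (Cn n)} (hU : ∀ z ∈ U, z ≠ 0) {p q : ℕ} {V : Fin n → Opens (Cn n)}
    (hVU : ∀ i, V i ≤ U) (hUV : ∀ i, ∀ z ∈ U, z i ≠ 0 → z ∈ V i) (η : ∀ i, Forms (V i) p q)
    {z : Cn n} (hz : z ∈ U) {φ : AltForm n (p + q)} (hφ : ∀ i, z i ≠ 0 → (η i).val z = φ) :
    (∑ i, mulExtend i (hVU i) (hUV i) hU (η i)).val z = φ := by
  rw [Forms.val_sum]
  have : ∀ i, (mulExtend i (hVU i) (hUV i) hU (η i)).val z = partitionFun i z • φ := fun i => by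
    rw [mulExtend_val]
    by_cases hi : z i = 0
    · have h0 : partitionFun i z = 0 := (partitionFun_eventuallyEq_zero (hU z hz) hi).self_of_nhds
      ext w
      simp [h0]
    · rw [hφ i hi]
  rw [Finset.sum_congr rfl fun i _ => this i, ← Finset.sum_smul, sum_partitionFun (hU z hz),
    one_smul]

end PartitionOfUnity

/-! ### The Čech homotopy and injectivity of the map from Dolbeault cohomology -/

section Injectivity

variable {n : ℕ}

lemma cechDiff_cechDbar {ι : Type*} (W : ι → Opens (Cn n)) (p q a : ℕ)
    (σ : CechCochain W p q a) :
    cechDiff W p (q + 1) a (cechDbar W p q a σ) =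
      cechDbar W p q (a + 1) (cechDiff W p q a σ) := by
  funext α
  have h1 : ∀ (q : ℕ) (σ : CechCochain W p q a), cechDiff W p q a σ α =
      ∑ ν : Fin (a + 2), (-1 : ℂ) ^ (ν : ℕ) •
        restrict (inter_le_comp W α ν.succAbove) p q (σ (α ∘ ν.succAbove)) := fun q σ => by
    simp [cechDiff]
  change _ = dbar (inter W α) p q (cechDiff W p q a σ α)
  rw [h1, h1, map_sum]
  refine Finset.sum_congr rfl fun ν _ => ?_
  rw [map_smul, dbar_restrict]
  rfl

lemma cechDbar_cechDbar {ι : Type*} (W : ι → Opens (Cn n)) (p q a : ℕ)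
    (σ : CechCochain W p q a) :
    cechDbar W p (q + 1) a (cechDbar W p q a σ) = 0 :=
  funext fun _ => dbar_dbar _ p q _

/-- The contracting homotopy of the Čech complex of smooth forms. -/
def cechHomotopy {p q a : ℕ} (σ : CechCochain (coordCover n) p q (a + 1)) :
    CechCochain (coordCover n) p q a := fun α =>
  ∑ i, mulExtend i (V := inter (coordCover n) (Fin.cons i α : Fin (a + 2) → Fin n))
    (fun _ hz => Set.mem_iInter.2 fun j : Fin (a + 1) => Set.mem_iInter.1 hz j.succ)
    (fun _ hz hi => Set.mem_iInter.2 fun j => Fin.cases hi (fun j => Set.mem_iInter.1 hz j) j)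
    (fun _ hz => ne_zero_of_mem_inter hz) (σ (Fin.cons i α))

/-- Evaluated on the tuple (i, α), the cocycle condition expresses σ_α as ∑_ν (-1)^ν σ_{(i, α
without ν)}. Averaging this over i with the partition of unity is the claim. -/
lemma cechDiff_cechHomotopy {p q a : ℕ} {σ : CechCochain (coordCover n) p q (a + 1)}
    (hσ : cechDiff (coordCover n) p q (a + 1) σ = 0) :
    cechDiff (coordCover n) p q a (cechHomotopy σ) = σ := by
  funext α
  refine Forms.ext_of_mem fun z hz => ?_
  rw [cechDiff_val _ _ _ _ _ hz]
  have h0 := ne_zero_of_mem_inter hz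
  have h1 : ∀ i, z i ≠ 0 → ∑ ν : Fin (a + 2), (-1 : ℂ) ^ (ν : ℕ) •
      (σ (Fin.cons i (α ∘ ν.succAbove))).val z = (σ α).val z := by
    intro i hi
    have hz' : z ∈ inter (coordCover n) (Fin.cons i α : Fin (a + 3) → Fin n) :=
      Set.mem_iInter.2 fun j => Fin.cases hi (fun j => Set.mem_iInter.1 hz j) j
    have h2 := cechDiff_val p q (a + 1) σ (Fin.cons i α) hz'
    rw [hσ, Fin.sum_univ_succ] at h2
    have e0 : (Fin.cons i α : Fin (a + 3) → Fin n) ∘ Fin.succAbove 0 = α := by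
      funext j
      simp
    have e1 : ∀ ν : Fin (a + 2), (Fin.cons i α : Fin (a + 3) → Fin n) ∘ Fin.succAbove ν.succ =
        Fin.cons i (α ∘ ν.succAbove) := fun ν => by
      funext j
      refine Fin.cases ?_ (fun j => ?_) j
      · simp
      · simp [Fin.succ_succAbove_succ]
    have e2 : ∀ ν : Fin (a + 2),
        (σ ((Fin.cons i α : Fin (a + 3) → Fin n) ∘ Fin.succAbove ν.succ)).val z =
          (σ (Fin.cons i (α ∘ ν.succAbove))).val z := fun ν => by rw [e1]
    rw [e0] at h2
    simp only [e2] at h2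
    ext w
    have h3 := congrArg (fun G : AltForm n (p + q) => G w) h2
    simp only [Forms.val_zero, Pi.zero_apply, ContinuousAlternatingMap.coe_zero,
      ContinuousAlternatingMap.add_apply, ContinuousAlternatingMap.sum_apply,
      ContinuousAlternatingMap.smul_apply, smul_eq_mul, Fin.val_zero, pow_zero, one_mul,
      Fin.val_succ, pow_succ, mul_neg_one, neg_mul, Finset.sum_neg_distrib] at h3
    simp only [ContinuousAlternatingMap.sum_apply, ContinuousAlternatingMap.smul_apply, smul_eq_mul]
    linear_combination h3
  have h2 : ∀ ν : Fin (a + 2), (cechHomotopy σ (α ∘ ν.succAbove)).val z =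
      ∑ i, partitionFun i z • (σ (Fin.cons i (α ∘ ν.succAbove))).val z := fun ν => by
    rw [cechHomotopy, Forms.val_sum]
    rfl
  simp only [h2, Finset.smul_sum]
  rw [Finset.sum_comm]
  have h3 : ∀ i, ∑ ν : Fin (a + 2), (-1 : ℂ) ^ (ν : ℕ) • partitionFun i z •
      (σ (Fin.cons i (α ∘ ν.succAbove))).val z = partitionFun i z • (σ α).val z := by
    intro i
    by_cases hi : z i = 0
    · have h4 : partitionFun i z = 0 := (partitionFun_eventuallyEq_zero h0 hi).self_of_nhds
      ext w
      simp [h4]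
    · rw [← h1 i hi, Finset.smul_sum]
      exact Finset.sum_congr rfl fun ν _ => smul_comm _ _ _
  rw [Finset.sum_congr rfl fun i _ => h3 i, ← Finset.sum_smul, sum_partitionFun h0, one_smul]

/-- A Čech–Dolbeault cochain with coboundary in bidegree `(0, q + 1)` can be modified so that its
components become `δ̌`-closed. -/
lemma exists_cechDiff_eq_zero {p q : ℕ} {ξ : CDCochain (coordCover n) p q}
    {η : Forms (punctured n) p (q + 1)}
    (h : cdDiff (coordCover n) p q ξ = formToCD (iSup_coordCover n) p (q + 1) η) :
    ∀ (b a : ℕ) (hab : a + b = q), ∃ θ : CechCochain (coordCover n) p b a,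
      cechDiff (coordCover n) p b a θ = 0 ∧
        cechDbar (coordCover n) p b a θ = cechDbar (coordCover n) p b a (ξ ⟨(a, b), hab⟩) := by
  intro b
  induction b with
  | zero =>
    intro a hab
    refine ⟨ξ ⟨(a, 0), hab⟩, ?_, rfl⟩
    have h1 := congrFun h ⟨(a + 1, 0), by omega⟩
    rw [formToCD_succ] at h1
    change cechDiff (coordCover n) p 0 a (ξ ⟨(a, 0), _⟩) + (-1 : ℂ) ^ (a + 1) • 0 = 0 at h1
    rwa [smul_zero, add_zero] at h1
  | succ b ih =>
    intro a hab
    -- Subtracting a ∂̄-exact term does not change ∂̄ of the component. The homotopy applied to the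
    -- already corrected component one Čech degree higher gives a term whose Čech differential is
    -- the obstruction (-1)^{a+1} ∂̄ξ^{a+1}, up to sign.
    obtain ⟨θ, hθ, hθ'⟩ := ih (a + 1) (by omega)
    refine ⟨ξ ⟨(a, b + 1), hab⟩ + (-1 : ℂ) ^ (a + 1) •
      cechDbar (coordCover n) p b a (cechHomotopy θ), ?_, ?_⟩
    · have h1 := congrFun h ⟨(a + 1, b + 1), by omega⟩
      rw [formToCD_succ] at h1
      change cechDiff (coordCover n) p (b + 1) a (ξ ⟨(a, b + 1), _⟩) +
        (-1 : ℂ) ^ (a + 1) • cechDbar (coordCover n) p b (a + 1) (ξ ⟨(a + 1, b), _⟩) = 0 at h1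
      rw [map_add, map_smul, cechDiff_cechDbar, cechDiff_cechHomotopy hθ, hθ', h1]
    · rw [map_add, map_smul, cechDbar_cechDbar, smul_zero, add_zero]

/-- A smooth form on the punctured space whose image is a Čech–Dolbeault coboundary is
`∂̄`-exact. -/
lemma exists_dbar_eq {p q : ℕ} {ξ : CDCochain (coordCover n) p q}
    {η : Forms (punctured n) p (q + 1)}
    (h : cdDiff (coordCover n) p q ξ = formToCD (iSup_coordCover n) p (q + 1) η) :
    ∃ ζ, dbar (punctured n) p q ζ = η := by
  -- In Čech degree 0, being δ̌-closed means that the local primitives agree on overlaps.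
  obtain ⟨θ, hθ, hθ'⟩ := exists_cechDiff_eq_zero h q 0 (zero_add q)
  have h1 : ∀ i, dbar _ p q (θ fun _ => i) =
      restrict (inter_le_of_le (a := 0) (iSup_coordCover n) fun _ => i) p (q + 1) η := by
    intro i
    have h2 := congrFun h ⟨(0, q + 1), by omega⟩
    change (0 : CechCochain (coordCover n) p (q + 1) 0) +
      (-1 : ℂ) ^ 0 • cechDbar (coordCover n) p q 0 (ξ ⟨(0, q), _⟩) = _ at h2
    rw [zero_add, pow_zero, one_smul, ← hθ'] at h2
    exact (congrFun h2 fun _ => i).trans (formToCD_zero _ _ _ _ _)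
  have hV : ∀ (i : Fin n) (z : Cn n), z i ≠ 0 → z ∈ inter (coordCover n) (fun _ : Fin 1 => i) :=
    fun i z hi => Set.mem_iInter.2 fun _ => hi
  have h3 : ∀ (i j : Fin n) (z : Cn n), z i ≠ 0 → z j ≠ 0 →
      (θ fun _ => i).val z = (θ fun _ => j).val z := by
    intro i j z hi hj
    have hz : z ∈ inter (coordCover n) (Fin.cons i (fun _ => j) : Fin 2 → Fin n) :=
      Set.mem_iInter.2 fun l => Fin.cases hi (fun _ => hj) l
    have h4 := cechDiff_val p q 0 θ (Fin.cons i fun _ => j) hz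
    have e0 : (Fin.cons i (fun _ => j) : Fin 2 → Fin n) ∘ Fin.succAbove 0 = fun _ => j := by
      funext l
      simp
    have e1 : (Fin.cons i (fun _ => j) : Fin 2 → Fin n) ∘ Fin.succAbove 1 = fun _ => i := by
      funext l
      obtain rfl : l = 0 := Subsingleton.elim _ _
      rfl
    rw [hθ, Fin.sum_univ_two, e0, e1] at h4
    ext w
    have h5 := congrArg (fun G : AltForm n (p + q) => G w) h4
    simp only [Pi.zero_apply, Forms.val_zero, Fin.val_zero, pow_zero, Fin.val_one, pow_one,
      ContinuousAlternatingMap.coe_zero, ContinuousAlternatingMap.add_apply,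
      ContinuousAlternatingMap.smul_apply, smul_eq_mul] at h5
    linear_combination h5
  -- The partition of unity serves here only to glue: the sum restricts to each local primitive,
  -- since all of them agree where they are defined.
  refine ⟨∑ i, mulExtend i (V := inter (coordCover n) fun _ : Fin 1 => i)
    (inter_le_of_le (a := 0) (iSup_coordCover n) fun _ => i) (fun z _ hi => hV i z hi)
    (fun z hz => hz) (θ fun _ => i), Forms.ext_of_mem fun z hz => ?_⟩
  obtain ⟨i, hi⟩ : ∃ i, z i ≠ 0 := by
    by_contra h
    push Not at h
    exact hz (PiLp.ext h)
  have hle := inter_le_of_le (a := 0) (iSup_coordCover n) fun _ => i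
  rw [← restrict_apply_of_mem hle p (q + 1) η (hV i z hi), ← h1 i,
    ← restrict_apply_of_mem hle p (q + 1) _ (hV i z hi), ← dbar_restrict]
  congr 2
  refine Forms.ext_of_mem fun y hy => ?_
  rw [restrict_apply_of_mem _ _ _ _ hy]
  have hi' : y i ≠ 0 := Set.mem_iInter.1 hy 0
  exact sum_mulExtend_val (fun z hz => hz) _ _ _ (hle hy) fun j hj => h3 j i y hj hi'

lemma formToCD_injective (p q : ℕ) :
    Function.Injective (formToCD (iSup_coordCover n) p q) := by
  rw [injective_iff_map_eq_zero]
  intro η h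
  refine Forms.ext_of_mem fun z hz => ?_
  obtain ⟨i, hi⟩ : ∃ i, z i ≠ 0 := by
    by_contra h
    push Not at h
    exact hz (PiLp.ext h)
  have h1 := formToCD_zero (iSup_coordCover n) p q η fun _ => i
  rw [h] at h1
  rw [← restrict_apply_of_mem (inter_le_of_le (a := 0) (iSup_coordCover n) fun _ => i) p q η
    (Set.mem_iInter.2 fun _ => hi), ← h1]
  rfl

/-- In degree 0 there are no coboundaries and the claim is that a form is determined by its
restrictions to the covering. In positive degree a Čech–Dolbeault primitive is converted into a
global ∂̄-primitive. -/
lemma dolbeaultToCD_injective (p q : ℕ) :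
    Function.Injective (dolbeaultToCD (iSup_coordCover n) p q) := by
  rw [injective_iff_map_eq_zero]
  intro x hx
  obtain ⟨⟨η, hη⟩, rfl⟩ := Submodule.Quotient.mk_surjective _ x
  have h1 := (Submodule.Quotient.mk_eq_zero _).1 hx
  refine (Submodule.Quotient.mk_eq_zero _).2 ?_
  cases q with
  | zero =>
    have h2 : formToCD (iSup_coordCover n) p 0 η = 0 := h1
    exact formToCD_injective p 0 (h2.trans (map_zero _).symm)
  | succ q =>
    obtain ⟨ξ, hξ⟩ := h1
    exact exists_dbar_eq (ξ := ξ) (η := η) hξ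

end Injectivity

lemma dolbeaultToCD_bochnerMartinelliClass (m : ℕ)
    (hβ : dbar (punctured (m + 1)) (m + 1) m (bochnerMartinelli m) = 0)
    (hκ : holDiff (coordCover (m + 1)) (m + 1) m (cauchyCochain m) = 0) :
    dolbeaultToCD (iSup_coordCover (m + 1)) (m + 1) m (bochnerMartinelliClass m hβ) =
      cechToCD (coordCover (m + 1)) (m + 1) m
        ((-1 : ℂ) ^ ((m + 1) * m / 2) • cauchyClass m hκ) := by
  rw [map_smul]
  exact (Submodule.Quotient.eq _).2 (formToCD_sub_holToCD_mem m)

end CechDolbeault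

end

theorem theorem8p1 (m : ℕ) :
    ∃ (hβ : dbar (punctured (m + 1)) (m + 1) m (bochnerMartinelli m) = 0)
      (hκ : holDiff (coordCover (m + 1)) (m + 1) m (cauchyCochain m) = 0),
      dolbeaultToCD (iSup_coordCover (m + 1)) (m + 1) m (bochnerMartinelliClass m hβ) =
          cechToCD (coordCover (m + 1)) (m + 1) m
            ((-1 : ℂ) ^ ((m + 1) * m / 2) • cauchyClass m hκ) ∧
        ∀ Φ : DolbeaultH (punctured (m + 1)) (m + 1) m ≃ₗ[ℂ] CechH (coordCover (m + 1)) (m + 1) m,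
          (∀ a, cechToCD (coordCover (m + 1)) (m + 1) m (Φ a) =
            dolbeaultToCD (iSup_coordCover (m + 1)) (m + 1) m a) →
          Φ (bochnerMartinelliClass m hβ) =
            (-1 : ℂ) ^ ((m + 1) * m / 2) • cauchyClass m hκ := by
  refine ⟨dbar_bochnerMartinelli m, holDiff_cauchyCochain m,
    dolbeaultToCD_bochnerMartinelliClass m _ _, fun Φ hΦ => ?_⟩
  -- Pulling the equation back along Φ places both sides in Dolbeault cohomology, where injectivity
  -- of ι applies; injectivity of j is not needed.
  rw [← Φ.eq_symm_apply]
  refine dolbeaultToCD_injective (m + 1) m ?_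
  rw [← hΦ (Φ.symm _), Φ.apply_symm_apply]
  exact dolbeaultToCD_bochnerMartinelliClass m _ _
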